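/- Let $M$ be a closed connected $3$-manifold, let $D^2\subset\mathbb C$ be the closed unit disc, let $\varphi\colon S^1\times D^2\to M$ be an embedding, and fix a homeomorphism $D^2\cong[1/3,2/3]^2$. Let $V=[0,1]\times S^1\times D^2/\!\sim$ with $(0,\lambda,z)\sim(1,\bar\lambda,\bar z)$, and let $\psi\colon S^1\times D^2\cong S^1\times[1/3,2/3]^2\to V$ be the map $(\lambda,s,t)\mapsto[s,\lambda,\exp(2\pi i t)]$ into $\partial V=\{[s,\lambda,z] : |z|=1\}$. The standard cobordism is $W=([0,1]\times M)\cup_{S^1\times D^2}V$, where $(1,\varphi(p))$ is identified with $\psi(p)$ for all $p\in S^1\times D^2$. Its boundary $\partial W$ is the union of $\{0\}\times M$, of $\{1\}\times\bigl(M\setminus\varphi(S^1\times\operatorname{int}D^2)\bigr)$ and of $\partial V\setminus\psi(S^1\times\operatorname{int}D^2)$. Let $\alpha\colon\pi_1(W)\to SU_2$ be a homomorphism, and let $H^*(\,\cdot\,;\alpha)$ denote singular cohomology with coefficients in the local system on $W$ (restricted to subspaces of $W$) with fibre $su_2\otimes\mathbb C$ that is given by $\mathrm{Ad}\circ\alpha$.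 Put $$H^2_{L^2}(W;\alpha)=\ker\bigl(H^2(W;\alpha)\to H^2(\partial W;\alpha)\bigr).$$ Regard $M$ as $\{1\}\times M\subset W$. Then there is an injective linear map $$\iota\colon H^2_{L^2}(W;\alpha)\hookrightarrow\operatorname{coker}\bigl(H^1(M;\alpha)\oplus H^1(V;\alpha)\to H^1(S^1\times D^2;\alpha)\bigr),$$ where the map on the right is the difference of the restrictions. It is inverse to the Mayer–Vietoris connecting homomorphism $\delta\colon H^1(S^1\times D^2;\alpha)\to H^2(W;\alpha)$ of the decomposition $W=([0,1]\times M)\cup V$: for $c\in H^2_{L^2}(W;\alpha)$ and $b\in H^1(S^1\times D^2;\alpha)$, one has $\iota(c)=[b]$ if and only if $\delta(b)=c$. -/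

import Mathlib

open scoped TensorProduct Matrix
open Topology

/-! ## Singular cohomology with coefficients in a representation of the fundamental group -/

namespace Twisted

/-- The standard `n`-simplex. -/
abbrev Simp (n : ℕ) : Type := stdSimplex ℝ (Fin (n + 1))

/-- The zeroth vertex of the standard simplex. -/
noncomputable def base (n : ℕ) : Simp n := stdSimplex.vertex 0

/-- The `i`-th face map of the standard simplex (its image is the face opposite to vertex `i`). -/
noncomputable def faceMap {n : ℕ} (i : Fin (n + 2)) : C(Simp n, Simp (n + 1)) :=
  ⟨stdSimplex.map i.succAbove, stdSimplex.continuous_map _⟩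

/-- The straight path between two points of the standard simplex. -/
noncomputable def segPath {n : ℕ} (a b : Simp n) : Path a b where
  toFun t := ⟨(1 - (t : ℝ)) • (a : Fin (n + 1) → ℝ) + (t : ℝ) • (b : Fin (n + 1) → ℝ),
    convex_stdSimplex ℝ (Fin (n + 1)) a.2 b.2 (sub_nonneg.2 t.2.2) t.2.1 (by ring)⟩
  continuous_toFun := by fun_prop
  source' := by apply Subtype.ext; simp; rfl
  target' := by apply Subtype.ext; simp; rfl

/-- In the standard simplex, any two paths with the same endpoints are homotopic. -/
lemma simp_homotopic {n : ℕ} {a b : Simp n} (p q : Path a b) : p.Homotopic q := by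
  have : ContractibleSpace (Simp n) :=
    (convex_stdSimplex ℝ (Fin (n + 1))).contractibleSpace ⟨_, (base n).2⟩
  exact SimplyConnectedSpace.paths_homotopic p q

lemma faceMap_comp {n : ℕ} (i : Fin (n + 3)) (j : Fin (n + 2)) (hij : i ≤ j.castSucc)
    (h : (i : ℕ) < n + 2) :
    (faceMap j.succ).comp (faceMap (i.castLT h)) = (faceMap i).comp (faceMap j) := by
  ext1 x
  change stdSimplex.map _ (stdSimplex.map _ x) = stdSimplex.map _ (stdSimplex.map _ x)
  rw [stdSimplex.map_comp_apply, stdSimplex.map_comp_apply]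
  congr 1
  funext a
  rcases i with ⟨i, _⟩
  rcases j with ⟨j, _⟩
  rcases a with ⟨a, _⟩
  ext
  simp only [Function.comp_apply, Fin.succAbove, Fin.lt_def]
  split_ifs <;> · simp at * <;> lia

section Cochains

variable {X : Type*} [TopologicalSpace X]

/-- A singular `n`-simplex of `X` with values in the subset `S`, together with a homotopy class of
paths from `x₀` to the image of its zeroth vertex.  Identifying the universal cover of `X` with the
set of homotopy classes of paths that start at `x₀`, this is the same as a singular `n`-simplex of
the part of the universal cover that lies over `S`. -/
@[ext]
structure LiftedSimplex (x₀ : X) (S : Set X) (n : ℕ) where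
  /-- the simplex downstairs -/
  map : C(Simp n, X)
  mem : ∀ t, map t ∈ S
  /-- the lift of its zeroth vertex -/
  lift : Path.Homotopic.Quotient x₀ (map (base n))

namespace LiftedSimplex

variable {x₀ : X} {S T : Set X} {n : ℕ}

/-- The `i`-th face of a lifted simplex; the lift of the new zeroth vertex is obtained by following
the image of the segment from the old zeroth vertex to the new one. -/
noncomputable def face (i : Fin (n + 2)) (s : LiftedSimplex x₀ S (n + 1)) :
    LiftedSimplex x₀ S n where
  map := s.map.comp (faceMap i)
  mem _ := s.mem _
  lift := s.lift.trans
    (Path.Homotopic.Quotient.mk ((segPath (base (n + 1)) (faceMap i (base n))).map s.map.continuous))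

/-- The deck transformation given by `g`.  In Mathlib the product `g * h` of the fundamental group
is the class of the loop `h` followed by `g`, so that a left action is obtained by letting `g` put
the inverse of its loop in front of a path. -/
noncomputable def deck (g : FundamentalGroup X x₀) (s : LiftedSimplex x₀ S n) : LiftedSimplex x₀ S n where
  map := s.map
  mem := s.mem
  lift := (FundamentalGroup.toPath g⁻¹).trans s.lift

/-- A lifted simplex over `S` as a lifted simplex over a larger subset. -/
def incl (h : S ⊆ T) (s : LiftedSimplex x₀ S n) : LiftedSimplex x₀ T n where
  map := s.map
  mem t := h (s.mem t)
  lift := s.lift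

lemma deck_mul (g h : FundamentalGroup X x₀) (s : LiftedSimplex x₀ S n) :
    deck (g * h) s = deck g (deck h s) := by
  simp only [deck, mul_inv_rev]
  congr 1
  exact Path.Homotopic.Quotient.trans_assoc (FundamentalGroup.toPath g⁻¹) (FundamentalGroup.toPath h⁻¹) s.lift

lemma face_deck (g : FundamentalGroup X x₀) (i : Fin (n + 2)) (s : LiftedSimplex x₀ S (n + 1)) :
    face i (deck g s) = deck g (face i s) := by
  simp only [deck, face]
  congr 1
  exact Path.Homotopic.Quotient.trans_assoc _ _ _

/-- The lifted simplex obtained by composition with a map `f` of standard simplices. -/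
noncomputable def pull {m : ℕ} (f : C(Simp m, Simp n)) (p : Path (base n) (f (base m)))
    (s : LiftedSimplex x₀ S n) : LiftedSimplex x₀ S m where
  map := s.map.comp f
  mem _ := s.mem _
  lift := s.lift.trans (Path.Homotopic.Quotient.mk (p.map s.map.continuous))

lemma pull_congr {m : ℕ} {f g : C(Simp m, Simp n)} (hfg : f = g)
    (p : Path (base n) (f (base m))) (q : Path (base n) (g (base m)))
    (s : LiftedSimplex x₀ S n) : pull f p s = pull g q s := by
  subst hfg
  simp only [pull]
  congr 2
  exact Path.Homotopic.Quotient.eq.2 ((simp_homotopic p q).map s.map)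

lemma face_face_eq_pull (i : Fin (n + 3)) (j : Fin (n + 2)) (s : LiftedSimplex x₀ S (n + 2)) :
    face j (face i s) = pull ((faceMap i).comp (faceMap j))
      ((segPath (base (n + 2)) (faceMap i (base (n + 1)))).trans
        ((segPath (base (n + 1)) (faceMap j (base n))).map (faceMap i).continuous)) s := by
  simp only [face, pull]
  congr 1
  rw [Path.map_trans, Path.Homotopic.Quotient.mk_trans]
  exact Path.Homotopic.Quotient.trans_assoc _ _ _

lemma face_face (i : Fin (n + 3)) (j : Fin (n + 2)) (hij : i ≤ j.castSucc)
    (h : (i : ℕ) < n + 2) (s : LiftedSimplex x₀ S (n + 2)) :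
    face (i.castLT h) (face j.succ s) = face j (face i s) := by
  rw [face_face_eq_pull, face_face_eq_pull]
  exact pull_congr (faceMap_comp i j hij h) _ _ s

end LiftedSimplex

variable {k : Type*} [CommRing k] {E : Type*} [AddCommGroup E] [Module k E]
variable {x₀ : X} (ρ : Representation k (FundamentalGroup X x₀) E)

/-- The functions with values in `E` on the lifted simplices over `S` that are equivariant under the
deck transformations. -/
def cochainSubmodule (S : Set X) (n : ℕ) : Submodule k (LiftedSimplex x₀ S n → E) where
  carrier := {c | ∀ g s, c (s.deck g) = ρ g (c s)}
  add_mem' ha hb g s := by simp [ha g s, hb g s]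
  zero_mem' g s := by simp
  smul_mem' r c hc g s := by simp [hc g s]

/-- The `n`-cochains of the subset `S` of `X` with coefficients in the restriction to `S` of the
local system on `X` given by `ρ`: the equivariant functions with values in `E` on the singular
simplices of the part of the universal cover of `X` that lies over `S`. -/
def Cochain (S : Set X) (n : ℕ) : Type _ := cochainSubmodule ρ S n

noncomputable instance (S : Set X) (n : ℕ) : AddCommGroup (Cochain ρ S n) :=
  inferInstanceAs (AddCommGroup (cochainSubmodule ρ S n))

noncomputable instance (S : Set X) (n : ℕ) : Module k (Cochain ρ S n) :=
  inferInstanceAs (Module k (cochainSubmodule ρ S n))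

/-- The coboundary, `(d c)(s) = ∑ i, (-1) ^ i c(i-th face of s)`. -/
noncomputable def d (S : Set X) (n : ℕ) : Cochain ρ S n →ₗ[k] Cochain ρ S (n + 1) where
  toFun c := ⟨fun s => ∑ i : Fin (n + 2), (-1 : k) ^ (i : ℕ) • c.1 (s.face i), fun g s => by
    simp only [LiftedSimplex.face_deck, map_sum, map_smul]
    exact Finset.sum_congr rfl fun i _ => by rw [c.2]⟩
  map_add' a b := by
    refine Subtype.ext (funext fun s => ?_)
    change ∑ i : Fin (n + 2), (-1 : k) ^ (i : ℕ) • (a.1 (s.face i) + b.1 (s.face i)) =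
      ∑ i : Fin (n + 2), (-1 : k) ^ (i : ℕ) • a.1 (s.face i) +
        ∑ i : Fin (n + 2), (-1 : k) ^ (i : ℕ) • b.1 (s.face i)
    simp only [smul_add, Finset.sum_add_distrib]
  map_smul' r a := by
    refine Subtype.ext (funext fun s => ?_)
    change ∑ i : Fin (n + 2), (-1 : k) ^ (i : ℕ) • (r • a.1 (s.face i)) =
      r • ∑ i : Fin (n + 2), (-1 : k) ^ (i : ℕ) • a.1 (s.face i)
    rw [Finset.smul_sum]
    exact Finset.sum_congr rfl fun i _ => smul_comm _ _ _

/-- The coboundary applied twice vanishes. -/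
lemma d_d (S : Set X) (n : ℕ) (c : Cochain ρ S n) : d ρ S (n + 1) (d ρ S n c) = 0 := by
  refine Subtype.ext (funext fun s => ?_)
  change ∑ i : Fin (n + 3), (-1 : k) ^ (i : ℕ) • ∑ j : Fin (n + 2), (-1 : k) ^ (j : ℕ) •
    c.1 ((s.face i).face j) = 0
  simp only [Finset.smul_sum]
  rw [Finset.sum_comm]
  simp only [← Finset.sum_product']
  let P := Fin (n + 2) × Fin (n + 3)
  let Q : Finset P := {ij : P | (ij.2 : ℕ) ≤ (ij.1 : ℕ)}
  rw [Finset.univ_product_univ, ← Finset.sum_add_sum_compl Q, ← eq_neg_iff_add_eq_zero,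
    ← Finset.sum_neg_distrib]
  let φ : ∀ ij : P, ij ∈ Q → P := fun ij hij =>
    (Fin.castLT ij.2 (lt_of_le_of_lt (Finset.mem_filter.mp hij).right (Fin.is_lt ij.1)), ij.1.succ)
  apply Finset.sum_bij φ
  · intro ij hij
    simp_rw [Q, φ, Finset.compl_filter, Finset.mem_filter_univ, Fin.val_succ,
      Fin.val_castLT] at hij ⊢
    lia
  · rintro ⟨i, j⟩ hij ⟨i', j'⟩ hij' h
    rw [Prod.mk_inj]
    exact ⟨by simpa [φ] using! congr_arg Prod.snd h,
      by simpa [φ, Fin.castSucc_castLT] using! congr_arg Fin.castSucc (congr_arg Prod.fst h)⟩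
  · rintro ⟨i', j'⟩ hij'
    simp_rw [Q, Finset.compl_filter, Finset.mem_filter_univ, not_le] at hij'
    refine ⟨(j'.pred <| ?_, Fin.castSucc i'), ?_, ?_⟩
    · rintro rfl
      simp only [Fin.val_zero, not_lt_zero] at hij'
    · simpa [Q] using! Nat.le_sub_one_of_lt hij'
    · simp only [φ, Fin.castLT_castSucc, Fin.succ_pred]
  · rintro ⟨i, j⟩ hij
    have hle : (j : ℕ) ≤ (i : ℕ) := by simpa [Q] using hij
    dsimp only [φ]
    rw [LiftedSimplex.face_face j i hle (lt_of_le_of_lt hle i.2), smul_smul, smul_smul, ← neg_smul]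
    congr 1
    simp only [Fin.val_succ, Fin.val_castLT, pow_succ]
    ring

/-- Restriction of cochains to a smaller subset. -/
def resCochain {S T : Set X} (h : S ⊆ T) (n : ℕ) : Cochain ρ T n →ₗ[k] Cochain ρ S n where
  toFun c := ⟨fun s => c.1 (s.incl h), fun g s => c.2 g (s.incl h)⟩
  map_add' _ _ := rfl
  map_smul' _ _ := rfl

lemma d_resCochain {S T : Set X} (h : S ⊆ T) (n : ℕ) (c : Cochain ρ T n) :
    d ρ S n (resCochain ρ h n c) = resCochain ρ h (n + 1) (d ρ T n c) := rfl

/-- The cocycles. -/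
noncomputable def cocycles (S : Set X) (n : ℕ) : Submodule k (Cochain ρ S n) :=
  LinearMap.ker (d ρ S n)

/-- The coboundaries. -/
noncomputable def coboundaries (S : Set X) : (n : ℕ) → Submodule k (Cochain ρ S n)
  | 0 => ⊥
  | n + 1 => LinearMap.range (d ρ S n)

lemma coboundaries_le (S : Set X) (n : ℕ) : coboundaries ρ S n ≤ cocycles ρ S n := by
  cases n with
  | zero => exact bot_le
  | succ n =>
    rintro _ ⟨c, rfl⟩
    exact d_d ρ S n c

/-- The cohomology `Hⁿ(S; ρ)` of the subset `S` of `X` with coefficients in the restriction to `S`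
of the local system on `X` given by the representation `ρ` of the fundamental group of `X`. -/
abbrev H (S : Set X) (n : ℕ) : Type _ :=
  cocycles ρ S n ⧸ (coboundaries ρ S n).submoduleOf (cocycles ρ S n)

/-- The cohomology class of a cocycle. -/
noncomputable def cls {S : Set X} {n : ℕ} (z : cocycles ρ S n) : H ρ S n :=
  Submodule.Quotient.mk z

/-- Restriction of cocycles to a smaller subset. -/
noncomputable def resCocycle {S T : Set X} (h : S ⊆ T) (n : ℕ) :
    cocycles ρ T n →ₗ[k] cocycles ρ S n :=
  (resCochain ρ h n).restrict fun c hc => by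
    rw [cocycles, LinearMap.mem_ker] at hc ⊢
    rw [d_resCochain, hc, map_zero]

/-- Restriction of cohomology classes to a smaller subset. -/
noncomputable def res {S T : Set X} (h : S ⊆ T) (n : ℕ) : H ρ T n →ₗ[k] H ρ S n :=
  Submodule.mapQ _ _ (resCocycle ρ h n) <| by
    rintro ⟨c, hc⟩ hcb
    rw [Submodule.submoduleOf, Submodule.mem_comap] at hcb ⊢
    cases n with
    | zero =>
      change c = 0 at hcb
      change resCochain ρ h 0 c = 0
      rw [hcb, map_zero]
    | succ n =>
      obtain ⟨b, hb⟩ := hcb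
      change d ρ T n b = c at hb
      exact ⟨resCochain ρ h n b, by rw [d_resCochain, hb]; rfl⟩

/-- For `X = A ∪ B` and `C = A ∩ B`, the relation `δ b = c`, where
`δ : Hⁿ(C; ρ) → Hⁿ⁺¹(X; ρ)` is the connecting homomorphism of the Mayer-Vietoris sequence:
`b` is represented by `u|C - v|C` for cochains `u` on `A` and `v` on `B`, and `c` is represented by
a cocycle that restricts to `d u` on `A` and to `d v` on `B`. -/
def IsConnecting {A B C : Set X} (hA : C ⊆ A) (hB : C ⊆ B) {n : ℕ} (b : H ρ C n)
    (c : H ρ (Set.univ : Set X) (n + 1)) : Prop :=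
  ∃ (y : cocycles ρ C n) (z : cocycles ρ (Set.univ : Set X) (n + 1))
    (u : Cochain ρ A n) (v : Cochain ρ B n),
    cls ρ y = b ∧ cls ρ z = c ∧
    resCochain ρ hA n u - resCochain ρ hB n v = y.1 ∧
    resCochain ρ (Set.subset_univ A) (n + 1) z.1 = d ρ A n u ∧
    resCochain ρ (Set.subset_univ B) (n + 1) z.1 = d ρ B n v

end Cochains

end Twisted

/-! ## The adjoint representation -/

/-- The group `SU₂`. -/
abbrev SU2 : Type := Matrix.specialUnitaryGroup (Fin 2) ℂ

/-- The Lie algebra `su₂` of skew-Hermitian matrices of trace zero, as a real vector space. -/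
def su2 : Submodule ℝ (Matrix (Fin 2) (Fin 2) ℂ) where
  carrier := {X | Xᴴ = -X ∧ X.trace = 0}
  add_mem' := by
    rintro a b ⟨ha, ha'⟩ ⟨hb, hb'⟩
    exact ⟨by rw [Matrix.conjTranspose_add, ha, hb]; abel, by rw [Matrix.trace_add, ha', hb', add_zero]⟩
  zero_mem' := by simp
  smul_mem' := by
    rintro r a ⟨ha, ha'⟩
    exact ⟨by simp [Matrix.conjTranspose_smul, ha], by simp [Matrix.trace_smul, ha']⟩

/-- The adjoint action `X ↦ A X A⁻¹` of `SU₂` on `su₂`. -/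
noncomputable def Ad : Representation ℝ SU2 su2 where
  toFun A :=
    { toFun := fun X => ⟨(A : Matrix (Fin 2) (Fin 2) ℂ) * X.1 *
          ((A⁻¹ : SU2) : Matrix (Fin 2) (Fin 2) ℂ), by
        have hA : ((A⁻¹ : SU2) : Matrix (Fin 2) (Fin 2) ℂ) =
          (A : Matrix (Fin 2) (Fin 2) ℂ)ᴴ := rfl
        have h1 : ((A⁻¹ : SU2) : Matrix (Fin 2) (Fin 2) ℂ) * (A : Matrix (Fin 2) (Fin 2) ℂ) = 1 :=
          congrArg Subtype.val (inv_mul_cancel A)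
        refine ⟨?_, ?_⟩
        · rw [hA, Matrix.conjTranspose_mul, Matrix.conjTranspose_mul,
            Matrix.conjTranspose_conjTranspose, X.2.1]
          simp [Matrix.mul_assoc]
        · rw [Matrix.trace_mul_comm, ← Matrix.mul_assoc, h1, Matrix.one_mul, X.2.2]⟩
      map_add' := fun X Y => by
        apply Subtype.ext
        simp [Matrix.mul_add, Matrix.add_mul]
      map_smul' := fun r X => by
        apply Subtype.ext
        simp }
  map_one' := by
    ext1 X
    apply Subtype.ext
    simp
  map_mul' A B := by
    ext1 X
    apply Subtype.ext
    simp [Matrix.mul_assoc]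

/-- The complexified adjoint representation of `SU₂` on `ℂ ⊗ su₂`. -/
noncomputable def AdC : Representation ℂ SU2 (ℂ ⊗[ℝ] su2) where
  toFun A := (Ad A).baseChange ℂ
  map_one' := by
    rw [map_one]
    exact LinearMap.baseChange_id
  map_mul' A B := by
    rw [map_mul]
    exact LinearMap.baseChange_comp _ _

/-! ## The standard cobordism -/

namespace StdCobordism

/-- The closed unit disc `D²`. -/
abbrev Disc : Type := Metric.closedBall (0 : ℂ) 1

/-- The square `[1/3, 2/3]²`. -/
abbrev Square : Type := Set.Icc (1 / 3 : ℝ) (2 / 3) × Set.Icc (1 / 3 : ℝ) (2 / 3)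

/-- Complex conjugation on the disc. -/
noncomputable def conjDisc (z : Disc) : Disc :=
  ⟨starRingEnd ℂ z.1, by simpa only [mem_closedBall_zero_iff, RCLike.norm_conj] using z.2⟩

/-- A point of the circle as a point of the disc. -/
noncomputable def circleToDisc (z : Circle) : Disc := ⟨z, by rw [mem_closedBall_zero_iff]; exact (Circle.norm_coe z).le⟩

/-- The identification `(0, l, z) ∼ (1, l̄, z̄)` on `[0, 1] × S¹ × D²`; the conjugate of a point of
the circle is its inverse. -/
inductive VRel : unitInterval × Circle × Disc → unitInterval × Circle × Disc → Prop
  | glue (l : Circle) (z : Disc) : VRel (0, l, z) (1, l⁻¹, conjDisc z)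

/-- The space `V = [0, 1] × S¹ × D² / ∼`. -/
def V : Type := Quot VRel

instance : TopologicalSpace V := inferInstanceAs (TopologicalSpace (Quot VRel))

/-- The point of `V` represented by `(s, l, z)`. -/
def V.mk (s : unitInterval) (l : Circle) (z : Disc) : V := Quot.mk VRel (s, l, z)

/-- The map `S¹ × [1/3, 2/3]² → V`, `(l, s, t) ↦ (s, l, exp(2 π i t))`. -/
noncomputable def squareToV (l : Circle) (p : Square) : V :=
  V.mk ⟨p.1.1, by constructor <;> linarith [p.1.2.1, p.1.2.2]⟩ l
    (circleToDisc (Circle.exp (2 * Real.pi * p.2.1)))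

section

variable {M : Type*}

/-- The identification of the point `(1, φ (l, x))` of `[0, 1] × M` with the image of `(l, x)` under
`S¹ × D² → S¹ × [1/3, 2/3]² → V`, for `(l, x)` in `S¹ × D²`. -/
inductive WRel (φ : Circle × Disc → M) (h : Disc ≃ₜ Square) :
    (unitInterval × M) ⊕ V → (unitInterval × M) ⊕ V → Prop
  | glue (l : Circle) (x : Disc) :
      WRel φ h (Sum.inl (1, φ (l, x))) (Sum.inr (squareToV l (h x)))

/-- The standard cobordism `W = [0, 1] × M ∪ V`, glued along `S¹ × D²`. -/
def W (φ : Circle × Disc → M) (h : Disc ≃ₜ Square) : Type _ := Quot (WRel φ h)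

variable (φ : Circle × Disc → M) (h : Disc ≃ₜ Square)

instance [TopologicalSpace M] : TopologicalSpace (W φ h) := inferInstanceAs (TopologicalSpace (Quot (WRel φ h)))

/-- The map from `[0, 1] × M` to `W`. -/
def ofCyl (p : unitInterval × M) : W φ h := Quot.mk _ (Sum.inl p)

/-- The map from `V` to `W`. -/
def ofV (v : V) : W φ h := Quot.mk _ (Sum.inr v)

/-- The part `[0, 1] × M` of `W`. -/
def cylPart : Set (W φ h) := Set.range (ofCyl φ h)

/-- The end `{1} × M` of the cylinder as a part of `W`; it contains `S¹ × D²`. -/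
def MPart : Set (W φ h) := Set.range fun m : M => ofCyl φ h (1, m)

/-- The part `V` of `W`. -/
def VPart : Set (W φ h) := Set.range (ofV φ h)

/-- The part `S¹ × D²` of `W` along which `[0, 1] × M` and `V` are glued. -/
def tube : Set (W φ h) := Set.range fun p : Circle × Disc => ofV φ h (squareToV p.1 (h p.2))

/-- The open solid torus in `M`: the image of `S¹ ×` the open disc. -/
def openTubeM : Set M := {m | ∃ (l : Circle) (x : Disc), ‖x.1‖ < 1 ∧ φ (l, x) = m}

/-- The open solid torus in the boundary of `V`: the image of `S¹ ×` the open disc. -/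
def openTubeV : Set V := {v | ∃ (l : Circle) (x : Disc), ‖x.1‖ < 1 ∧ squareToV l (h x) = v}

/-- The boundary of `V`: the points represented by `(s, l, z)` with `|z| = 1`. -/
def boundaryV : Set V := {v | ∃ (s : unitInterval) (l : Circle) (z : Circle),
  V.mk s l (circleToDisc z) = v}

/-- The boundary of `W`.  It consists of `{0} × M`, of `{1} × M` without the open solid torus, and
of the boundary of `V` without the open solid torus. -/
def boundaryW : Set (W φ h) :=
  (Set.range fun m : M => ofCyl φ h (0, m)) ∪
  (fun m : M => ofCyl φ h (1, m)) '' (openTubeM φ)ᶜ ∪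
  ofV φ h '' (boundaryV \ openTubeV h)

lemma tube_subset_MPart : tube φ h ⊆ MPart φ h := by
  rintro _ ⟨⟨l, x⟩, rfl⟩
  exact ⟨φ (l, x), Quot.sound (WRel.glue l x)⟩

lemma MPart_subset_cylPart : MPart φ h ⊆ cylPart φ h := by
  rintro _ ⟨m, rfl⟩
  exact ⟨(1, m), rfl⟩

lemma tube_subset_cylPart : tube φ h ⊆ cylPart φ h :=
  (tube_subset_MPart φ h).trans (MPart_subset_cylPart φ h)

lemma tube_subset_VPart : tube φ h ⊆ VPart φ h := by
  rintro _ ⟨⟨l, x⟩, rfl⟩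
  exact ⟨_, rfl⟩

end

section

variable {M : Type*} [TopologicalSpace M] {φ : Circle × Disc → M} {h : Disc ≃ₜ Square}
  {w₀ : W φ h} (α : FundamentalGroup (W φ h) w₀ →* SU2)

/-- The coefficients: the complexified adjoint representation composed with `α`. -/
noncomputable def coeff : Representation ℂ (FundamentalGroup (W φ h) w₀) (ℂ ⊗[ℝ] su2) :=
  AdC.comp α

/-- The `L²`-cohomology `ker (H²(W; α) → H²(∂W; α))`. -/
noncomputable def L2H2 : Submodule ℂ (Twisted.H (coeff α) Set.univ 2) :=
  LinearMap.ker (Twisted.res (coeff α) (Set.subset_univ (boundaryW φ h)) 2)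

/-- The map `H¹(M; α) ⊕ H¹(V; α) → H¹(S¹ × D²; α)`, the difference of the two restrictions. -/
noncomputable def diffRes :
    (Twisted.H (coeff α) (MPart φ h) 1 × Twisted.H (coeff α) (VPart φ h) 1) →ₗ[ℂ]
      Twisted.H (coeff α) (tube φ h) 1 :=
  (Twisted.res (coeff α) (tube_subset_MPart φ h) 1).coprod
    (-Twisted.res (coeff α) (tube_subset_VPart φ h) 1)

/-- The cokernel of `H¹(M; α) ⊕ H¹(V; α) → H¹(S¹ × D²; α)`. -/
abbrev CokerH1 : Type _ :=
  Twisted.H (coeff α) (tube φ h) 1 ⧸ LinearMap.range (diffRes α)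

end

end StdCobordism

open StdCobordism

set_option linter.unusedSectionVars false

/-! A class of `H²(W)` that dies on `∂W` dies on both pieces of `W`: the cylinder deforms onto `{0}
× M`, and `V` deforms in itself to its points with `z = 1`, which avoid the glued solid torus; both
targets lie in `∂W` (`res_eq_zero_of_homotopy`). By Mayer–Vietoris such a class is `δ b` for some
`b`, unique up to the images of `H¹` of the cylinder and of `V`. Cocycles on `{1} × M` extend over
the cylinder by retraction (`exists_cocycle_extension`), so the cylinder may be replaced by `M`.
Sending `c` to the class of `b` gives `ι`, and `ι` is injective because `δ 0 = 0`. This formal part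
is `exists_connecting_inverse`.

The substance is that `δ`, given as a relation, is single-valued (`IsConnecting.eq_zero`). The two
pieces are closed, so this needs excision: a `2`-cocycle that vanishes on the simplices in either
piece must be a coboundary. A deformation of `W` pushes an open neighbourhood of the cylinder into
the cylinder and keeps `V` in `V`. The prism operator then replaces the cocycle by a cohomologous
one that vanishes on all simplices subordinate to an open cover (`exists_d_eq_of_deformation`).

Such a cocycle `z` is a coboundary (`exists_d_eq_of_vanishing`), which is shown without barycentric
subdivision. Inside one simplex, coning from a point `o` turns `z` into a function `z(o, p, q)` of
pairs that is additive on small triangles. By convexity it is locally a difference `Y q - Y p`. For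
an edge, the sum of `z` over the thin triangles spanned by its initial vertex and the pieces of a
subdivision therefore stabilises as the subdivision gets finer. Up to sign, the stable value is the
required `1`-cochain.

The coefficients are twisted, so all constructions are carried out on simplices with a lift of a
base point. They are natural in the simplex, which makes them commute with faces and deck
transformations. -/

namespace Twisted

/-! ### Affine simplices in convex sets -/

section Affine

variable {V : Type*} [AddCommGroup V] [Module ℝ V] [TopologicalSpace V]
  [IsTopologicalAddGroup V] [ContinuousSMul ℝ V] {C : Set V}

/-- The affine map from the standard simplex to a convex set with prescribed vertices. -/
noncomputable def aff (hC : Convex ℝ C) {m : ℕ} (q : Fin (m + 1) → C) : C(Simp m, C) where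
  toFun t := ⟨∑ i, t.1 i • (q i : V),
    hC.sum_mem (fun i _ => t.2.1 i) t.2.2 fun i _ => (q i).2⟩
  continuous_toFun := Continuous.subtype_mk (continuous_finsetSum _ fun i _ =>
    ((continuous_apply i).comp continuous_subtype_val).smul continuous_const) _

lemma aff_comp_faceMap (hC : Convex ℝ C) {m : ℕ} (q : Fin (m + 2) → C) (i : Fin (m + 2)) :
    (aff hC q).comp (faceMap i) = aff hC (q ∘ i.succAbove) := by
  ext t
  change ∑ j, FunOnFinite.linearMap ℝ ℝ i.succAbove t.1 j • (q j : V) =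
    ∑ j, t.1 j • (q (i.succAbove j) : V)
  simp only [FunOnFinite.linearMap_apply_apply, Finset.sum_smul]
  rw [← Finset.sum_fiberwise (s := Finset.univ) (g := i.succAbove)]
  refine Finset.sum_congr rfl fun j _ => Finset.sum_congr rfl fun l hl => ?_
  rw [(Finset.mem_filter.1 hl).2]

lemma comp_aff {V' : Type*} [AddCommGroup V'] [Module ℝ V'] [TopologicalSpace V']
    [IsTopologicalAddGroup V'] [ContinuousSMul ℝ V'] {C' : Set V'} (hC : Convex ℝ C)
    (hC' : Convex ℝ C') (L : V →ₗ[ℝ] V') (g : C(C, C')) (hg : ∀ x, (g x : V') = L x) {m : ℕ}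
    (q : Fin (m + 1) → C) : g.comp (aff hC q) = aff hC' (g ∘ q) := by
  ext t
  simp [aff, hg]

lemma aff_vertex {n : ℕ} :
    aff (convex_stdSimplex ℝ (Fin (n + 1))) (fun i => stdSimplex.vertex i) =
      ContinuousMap.id (Simp n) := by
  ext t j
  change (∑ i, t.1 i • (Pi.single i (1 : ℝ) : Fin (n + 1) → ℝ)) j = t.1 j
  simp [Finset.sum_apply, Pi.single_apply]

end Affine

/-! ### Lifted maps on convex sets -/

section LiftedMaps

variable {X : Type*} [TopologicalSpace X]

/-- A map from a convex set to `S` with a lift of the image of a base point. -/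
structure LiftedMap (x₀ : X) (S : Set X) {V : Type*} [AddCommGroup V] [Module ℝ V]
    [TopologicalSpace V] (C : Set V) where
  map : C(C, X)
  mem : ∀ t, map t ∈ S
  pt : C
  lift : Path.Homotopic.Quotient x₀ (map pt)

/-- The class of the paths between two points of a convex set. -/
noncomputable def segClass {V : Type*} [AddCommGroup V] [Module ℝ V] [TopologicalSpace V]
    [IsTopologicalAddGroup V] [ContinuousSMul ℝ V] {C : Set V} (hC : Convex ℝ C) (a b : C) :
    Path.Homotopic.Quotient a b :=
  have := hC.contractibleSpace ⟨_, a.2⟩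
  .mk (PathConnectedSpace.somePath a b)

/-- A convex set is contractible, hence simply connected. Comparisons of lifts come down to this
uniqueness, so the path chosen in `segClass` never matters. -/
lemma eq_segClass {V : Type*} [AddCommGroup V] [Module ℝ V] [TopologicalSpace V]
    [IsTopologicalAddGroup V] [ContinuousSMul ℝ V] {C : Set V} (hC : Convex ℝ C) {a b : C}
    (p : Path.Homotopic.Quotient a b) : p = segClass hC a b := by
  have := hC.contractibleSpace ⟨_, a.2⟩
  exact Subsingleton.elim _ _

lemma trans_map_trans_map {V : Type*} [AddCommGroup V] [Module ℝ V] [TopologicalSpace V]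
    [IsTopologicalAddGroup V] [ContinuousSMul ℝ V] {C : Set V} (hC : Convex ℝ C) {x₀ : X}
    (f : C(C, X)) {a b c : C} (l : Path.Homotopic.Quotient x₀ (f a))
    (p : Path.Homotopic.Quotient a b) (q : Path.Homotopic.Quotient b c) :
    (l.trans (p.map f)).trans (q.map f) = l.trans ((segClass hC a c).map f) := by
  rw [← eq_segClass hC (p.trans q)]
  obtain ⟨p, rfl⟩ := Path.Homotopic.Quotient.mk_surjective p
  obtain ⟨q, rfl⟩ := Path.Homotopic.Quotient.mk_surjective q
  rw [Path.Homotopic.Quotient.trans_assoc, ← Path.Homotopic.Quotient.mk_trans,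
    ← Path.Homotopic.Quotient.mk_map, ← Path.Homotopic.Quotient.mk_map,
    ← Path.Homotopic.Quotient.mk_map, Path.map_trans, Path.Homotopic.Quotient.mk_trans]

/-- The constant path as a path between two equal points. -/
def eqClass {a b : X} (h : a = b) : Path.Homotopic.Quotient a b :=
  (Path.Homotopic.Quotient.refl b).cast h rfl

lemma eqClass_trans_map {Y : Type*} [TopologicalSpace Y] {f g : C(Y, X)} (h : f = g) {a b : Y}
    (p : Path.Homotopic.Quotient a b) :
    (eqClass (congrFun (congrArg DFunLike.coe h) a)).trans (p.map g) =
      (p.map f).trans (eqClass (congrFun (congrArg DFunLike.coe h) b)) := by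
  subst h
  simp [eqClass]

/-- If the underlying maps are only propositionally equal, the lifts have different types. Composing
with the class of a constant path compares them without heterogeneous equality. -/
lemma LiftedSimplex.ext_of_eqClass {x₀ : X} {S : Set X} {n : ℕ} {s t : LiftedSimplex x₀ S n}
    (h : s.map = t.map)
    (hl : s.lift.trans (eqClass (congrFun (congrArg DFunLike.coe h) (base n))) = t.lift) :
    s = t := by
  obtain ⟨f, hf, l⟩ := s
  obtain ⟨g, hg, l'⟩ := t
  dsimp only at h
  subst h
  simp only [eqClass, Path.Homotopic.Quotient.cast_rfl_rfl,
    Path.Homotopic.Quotient.trans_refl] at hl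
  rw [hl]

namespace LiftedMap

variable {x₀ : X} {S : Set X} {V : Type*} [AddCommGroup V] [Module ℝ V] [TopologicalSpace V]
  [IsTopologicalAddGroup V] [ContinuousSMul ℝ V] {C : Set V}

/-- The lifted simplex given by a singular simplex of the source of a lifted map. -/
noncomputable def push (F : LiftedMap x₀ S C) (hC : Convex ℝ C) {m : ℕ} (τ : C(Simp m, C)) :
    LiftedSimplex x₀ S m where
  map := F.map.comp τ
  mem _ := F.mem _
  lift := F.lift.trans ((segClass hC F.pt (τ (base m))).map F.map)

/-- The lifted simplex given by the affine simplex with vertices `q`. -/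
noncomputable def simplex (F : LiftedMap x₀ S C) (hC : Convex ℝ C) {m : ℕ}
    (q : Fin (m + 1) → C) : LiftedSimplex x₀ S m :=
  F.push hC (aff hC q)

/-- The deck transformation given by `g`. -/
noncomputable def deck (g : FundamentalGroup X x₀) (F : LiftedMap x₀ S C) : LiftedMap x₀ S C where
  map := F.map
  mem := F.mem
  pt := F.pt
  lift := (FundamentalGroup.toPath g⁻¹).trans F.lift

lemma simplex_deck (g : FundamentalGroup X x₀) (F : LiftedMap x₀ S C) (hC : Convex ℝ C) {m : ℕ}
    (q : Fin (m + 1) → C) : (F.deck g).simplex hC q = (F.simplex hC q).deck g := by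
  simp only [simplex, push, deck, LiftedSimplex.deck]
  congr 1
  exact Path.Homotopic.Quotient.trans_assoc _ _ _

lemma face_push (F : LiftedMap x₀ S C) (hC : Convex ℝ C) {m : ℕ} (τ : C(Simp (m + 1), C))
    (i : Fin (m + 2)) : (F.push hC τ).face i = F.push hC (τ.comp (faceMap i)) := by
  simp only [push, LiftedSimplex.face]
  congr 1
  exact trans_map_trans_map hC F.map F.lift _
    (.mk ((segPath (base (m + 1)) (faceMap i (base m))).map τ.continuous))

lemma face_simplex (F : LiftedMap x₀ S C) (hC : Convex ℝ C) {m : ℕ} (q : Fin (m + 2) → C)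
    (i : Fin (m + 2)) : (F.simplex hC q).face i = F.simplex hC (q ∘ i.succAbove) := by
  rw [simplex, face_push, aff_comp_faceMap, simplex]

variable {V' : Type*} [AddCommGroup V'] [Module ℝ V'] [TopologicalSpace V']
  [IsTopologicalAddGroup V'] [ContinuousSMul ℝ V'] {C' : Set V'}

/-- Precomposition of a lifted map with a map of convex sets. -/
noncomputable def precomp (F : LiftedMap x₀ S C) (hC : Convex ℝ C) (g : C(C', C)) (c : C') :
    LiftedMap x₀ S C' where
  map := F.map.comp g
  mem _ := F.mem _
  pt := c
  lift := F.lift.trans ((segClass hC F.pt (g c)).map F.map)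

/-- As `g` is the restriction of a linear map, it takes affine simplices to affine simplices, and
the lifts agree by simple connectivity of `C`. This allows cochain values on a face to be computed
inside the whole simplex or prism. -/
lemma simplex_precomp (F : LiftedMap x₀ S C) (hC : Convex ℝ C) (hC' : Convex ℝ C')
    (L : V' →ₗ[ℝ] V) (g : C(C', C)) (hg : ∀ x, (g x : V) = L x) (c : C') {m : ℕ}
    (q : Fin (m + 1) → C') :
    (F.precomp hC g c).simplex hC' q = F.simplex hC (g ∘ q) := by
  rw [simplex, simplex, ← comp_aff hC' hC L g hg]
  simp only [push, precomp]
  congr 1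
  exact trans_map_trans_map hC F.map F.lift _ ((segClass hC' c (aff hC' q (base m))).map g)

end LiftedMap

end LiftedMaps

variable {X : Type*} [TopologicalSpace X] {x₀ : X} {S T : Set X} {n : ℕ}

lemma map_segClass_self {V : Type*} [AddCommGroup V] [Module ℝ V] [TopologicalSpace V]
    [IsTopologicalAddGroup V] [ContinuousSMul ℝ V] {C : Set V} (hC : Convex ℝ C) (a : C)
    (f : C(C, X)) : (segClass hC a a).map f = .refl (f a) := by
  rw [← eq_segClass hC (.refl a)]
  rfl

namespace LiftedSimplex

/-- A lifted simplex as a lifted map. -/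
noncomputable def toLiftedMap (s : LiftedSimplex x₀ S n) :
    LiftedMap x₀ S (stdSimplex ℝ (Fin (n + 1))) where
  map := s.map
  mem := s.mem
  pt := base n
  lift := s.lift

lemma simplex_toLiftedMap (s : LiftedSimplex x₀ S n) :
    s.toLiftedMap.simplex (convex_stdSimplex ℝ _) (fun i => stdSimplex.vertex i) = s := by
  rw [LiftedMap.simplex, aff_vertex]
  ext1
  · rfl
  · apply heq_of_eq
    change s.lift.trans ((segClass _ (base n) (base n)).map s.map) = _
    rw [map_segClass_self, Path.Homotopic.Quotient.trans_refl]

lemma toLiftedMap_face (s : LiftedSimplex x₀ S (n + 1)) (i : Fin (n + 2)) :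
    (s.face i).toLiftedMap =
      s.toLiftedMap.precomp (convex_stdSimplex ℝ _) (faceMap i) (base n) := by
  simp only [toLiftedMap, face, LiftedMap.precomp]
  congr 1
  rw [← eq_segClass _ (.mk (segPath (base (n + 1)) (faceMap i (base n))))]
  rfl

lemma simplex_toLiftedMap_face (s : LiftedSimplex x₀ S (n + 1)) (i : Fin (n + 2)) {m : ℕ}
    (q : Fin (m + 1) → Simp n) :
    (s.face i).toLiftedMap.simplex (convex_stdSimplex ℝ _) q =
      s.toLiftedMap.simplex (convex_stdSimplex ℝ _) (faceMap i ∘ q) := by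
  rw [toLiftedMap_face, LiftedMap.simplex_precomp _ _ (convex_stdSimplex ℝ _)
    (FunOnFinite.linearMap ℝ ℝ i.succAbove) _ fun _ => rfl]

end LiftedSimplex

/-! ### Prisms swept out by homotopies -/

/-- The prism over the standard simplex. -/
abbrev prismSet (n : ℕ) : Set ((Fin (n + 1) → ℝ) × ℝ) :=
  stdSimplex ℝ (Fin (n + 1)) ×ˢ Set.Icc 0 1

lemma convex_prismSet (n : ℕ) : Convex ℝ (prismSet n) :=
  (convex_stdSimplex ℝ _).prod (convex_Icc 0 1)

/-- A point of the prism. -/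
def prismPt (t : Simp n) (u : unitInterval) : prismSet n := ⟨(t.1, u.1), t.2, u.2⟩

/-- The section of the prism at a given height. -/
def prismSec (n : ℕ) (u : unitInterval) : C(Simp n, prismSet n) where
  toFun t := prismPt t u
  continuous_toFun := by unfold prismPt; fun_prop

lemma aff_prismPt_vertex (u : unitInterval) :
    aff (convex_prismSet n) (fun i => prismPt (stdSimplex.vertex i) u) = prismSec n u := by
  ext t j
  · change (∑ i, t.1 i • ((Pi.single i (1 : ℝ) : Fin (n + 1) → ℝ), u.1)).1 j = t.1 j
    simp [Prod.fst_sum, Finset.sum_apply, Pi.single_apply]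
  · change (∑ i, t.1 i • ((Pi.single i (1 : ℝ) : Fin (n + 1) → ℝ), u.1)).2 = u.1
    simp only [Prod.snd_sum, Prod.smul_snd, ← Finset.sum_smul]
    rw [t.2.2, one_smul]

/-- The map of prisms given by a face map. -/
noncomputable def prismFace (i : Fin (n + 2)) : C(prismSet n, prismSet (n + 1)) where
  toFun x := prismPt (faceMap i ⟨x.1.1, x.2.1⟩) ⟨x.1.2, x.2.2⟩
  continuous_toFun := by unfold prismPt; fun_prop

lemma prismFace_prismPt (i : Fin (n + 2)) (j : Fin (n + 1)) (u : unitInterval) :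
    prismFace i (prismPt (stdSimplex.vertex j) u) =
      prismPt (stdSimplex.vertex (i.succAbove j)) u := by
  change prismPt (stdSimplex.map _ (stdSimplex.vertex j)) u = _
  rw [stdSimplex.map_vertex]

namespace LiftedSimplex

variable (F : C(T × unitInterval, T)) (hF : ∀ x, F (x, 0) = x)

/-- The prism swept out by a lifted simplex under a homotopy. -/
noncomputable def prism (s : LiftedSimplex x₀ T n) : LiftedMap x₀ T (prismSet n) where
  map := ⟨fun x => (F (⟨s.map ⟨x.1.1, x.2.1⟩, s.mem _⟩, ⟨x.1.2, x.2.2⟩) : X), by fun_prop⟩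
  mem _ := (F _).2
  pt := prismPt (base n) 0
  lift := s.lift.trans (eqClass (congrArg Subtype.val (hF ⟨s.map (base n), s.mem _⟩)).symm)

lemma map_eq_prism_comp (s : LiftedSimplex x₀ T n) :
    s.map = (s.prism F hF).map.comp (prismSec n 0) := by
  ext t
  exact (congrArg Subtype.val (hF ⟨s.map t, s.mem _⟩)).symm

/-- The two lifts differ in the order in which the segment between zeroth vertices and the
identification `F (x, 0) = x` are followed; `eqClass_trans_map` interchanges them. -/
lemma prism_face (s : LiftedSimplex x₀ T (n + 1)) (i : Fin (n + 2)) :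
    (s.face i).prism F hF = (s.prism F hF).precomp (convex_prismSet _) (prismFace i)
      (prismPt (base n) 0) := by
  have key := eqClass_trans_map (s.map_eq_prism_comp F hF)
    (.mk (segPath (base (n + 1)) (faceMap i (base n))))
  simp only [prism, face, LiftedMap.precomp]
  congr 1
  refine (Path.Homotopic.Quotient.trans_assoc _ _ _).trans ?_
  refine Eq.trans ?_ (Path.Homotopic.Quotient.trans_assoc _ _ _).symm
  have hseg : (Path.Homotopic.Quotient.mk (segPath (base (n + 1)) (faceMap i (base n)))).map
      (prismSec (n + 1) 0) = segClass (convex_prismSet _) (prismPt (base (n + 1)) 0)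
        (prismFace i (prismPt (base n) 0)) := eq_segClass _ _
  refine congrArg s.lift.trans (key.symm.trans ?_)
  exact congrArg (fun r : Path.Homotopic.Quotient (prismPt (base (n + 1)) 0)
    (prismFace i (prismPt (base n) 0)) => (eqClass _).trans (r.map (s.prism F hF).map)) hseg

lemma prism_deck (g : FundamentalGroup X x₀) (s : LiftedSimplex x₀ T n) :
    (s.deck g).prism F hF = (s.prism F hF).deck g := by
  simp only [prism, deck, LiftedMap.deck]
  congr 1
  exact Path.Homotopic.Quotient.trans_assoc _ _ _

lemma simplex_prism_face (s : LiftedSimplex x₀ T (n + 1)) (i : Fin (n + 2)) {m : ℕ}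
    (q : Fin (m + 1) → prismSet n) :
    ((s.face i).prism F hF).simplex (convex_prismSet _) q =
      (s.prism F hF).simplex (convex_prismSet _) (prismFace i ∘ q) := by
  rw [prism_face, LiftedMap.simplex_precomp _ _ (convex_prismSet _)
    ((FunOnFinite.linearMap ℝ ℝ i.succAbove).prodMap LinearMap.id) _ fun _ => rfl]

lemma simplex_prism_zero (s : LiftedSimplex x₀ T n) :
    (s.prism F hF).simplex (convex_prismSet _) (fun i => prismPt (stdSimplex.vertex i) 0) = s := by
  rw [LiftedMap.simplex, aff_prismPt_vertex]
  refine (ext_of_eqClass (s.map_eq_prism_comp F hF) ?_).symm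
  change _ = (s.prism F hF).lift.trans
    ((segClass _ (prismPt (base n) 0) (prismPt (base n) 0)).map (s.prism F hF).map)
  rw [map_segClass_self]
  exact (Path.Homotopic.Quotient.trans_refl (s.prism F hF).lift).symm

/-- The end of the prism swept out by a lifted simplex under a homotopy. -/
noncomputable def homotopyEnd (s : LiftedSimplex x₀ T n) : LiftedSimplex x₀ T n :=
  (s.prism F hF).simplex (convex_prismSet _) (fun i => prismPt (stdSimplex.vertex i) 1)

lemma homotopyEnd_map (s : LiftedSimplex x₀ T n) (t : Simp n) :
    (s.homotopyEnd F hF).map t = F (⟨s.map t, s.mem t⟩, 1) := by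
  rw [homotopyEnd, LiftedMap.simplex, aff_prismPt_vertex]
  rfl

lemma homotopyEnd_face (s : LiftedSimplex x₀ T (n + 1)) (i : Fin (n + 2)) :
    (s.face i).homotopyEnd F hF = (s.homotopyEnd F hF).face i := by
  rw [homotopyEnd, homotopyEnd, LiftedMap.face_simplex, simplex_prism_face]
  congr 1
  funext j
  exact prismFace_prismPt i j 1

lemma homotopyEnd_deck (g : FundamentalGroup X x₀) (s : LiftedSimplex x₀ T n) :
    (s.deck g).homotopyEnd F hF = (s.homotopyEnd F hF).deck g := by
  rw [homotopyEnd, homotopyEnd, prism_deck, LiftedMap.simplex_deck]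

/-- The projection of the prism to the standard simplex. -/
def prismProj (n : ℕ) : C(prismSet n, Simp n) where
  toFun x := ⟨x.1.1, x.2.1⟩
  continuous_toFun := by fun_prop

/-- For a stationary homotopy the prism factors through its projection to the simplex, so the
vertical path along which the lift is transported becomes a constant loop. -/
lemma homotopyEnd_eq_self (s : LiftedSimplex x₀ T n)
    (hs : ∀ t u, F (⟨s.map t, s.mem t⟩, u) = ⟨s.map t, s.mem t⟩) : s.homotopyEnd F hF = s := by
  have hmap : (s.prism F hF).map = s.map.comp (prismProj n) := by
    ext x
    exact congrArg Subtype.val (hs ⟨x.1.1, x.2.1⟩ ⟨x.1.2, x.2.2⟩)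
  rw [homotopyEnd, LiftedMap.simplex, aff_prismPt_vertex]
  refine ext_of_eqClass (by ext t; exact congrArg Subtype.val (hs t 1)) ?_
  have key := eqClass_trans_map hmap (segClass (convex_prismSet n) (prismPt (base n) 0)
    (prismPt (base n) 1))
  have hloop : (segClass (convex_prismSet n) (prismPt (base n) 0)
      (prismPt (base n) 1)).map (s.map.comp (prismProj n)) = .refl (s.map (base n)) := by
    have h2 : (segClass (convex_prismSet n) (prismPt (base n) 0)
      (prismPt (base n) 1)).map (prismProj n) = .refl (base n) :=
      (eq_segClass (convex_stdSimplex ℝ _) _).trans (eq_segClass (convex_stdSimplex ℝ _) _).symm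
    obtain ⟨p, hp⟩ := Path.Homotopic.Quotient.mk_surjective
      (segClass (convex_prismSet n) (prismPt (base n) 0) (prismPt (base n) 1))
    rw [← hp] at h2 ⊢
    exact congrArg (fun r => Path.Homotopic.Quotient.map r s.map) h2
  rw [hloop] at key
  replace key := (Path.Homotopic.Quotient.trans_refl _).symm.trans key
  refine (Path.Homotopic.Quotient.trans_assoc _ _ _).trans ?_
  refine (congrArg (s.prism F hF).lift.trans key.symm).trans ?_
  refine (Path.Homotopic.Quotient.trans_assoc _ _ _).trans ?_
  have aux : ∀ {a b : X} (h : a = b) (h' : b = a) (l : Path.Homotopic.Quotient x₀ a),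
      l.trans ((eqClass h).trans (eqClass h')) = l := by
    rintro a _ rfl _ l
    simp [eqClass]
  exact aux _ _ _

end LiftedSimplex

/-! ### The prism operator in degree two -/

section Cochains

variable {k : Type*} [CommRing k] {E : Type*} [AddCommGroup E] [Module k E]
variable (ρ : Representation k (FundamentalGroup X x₀) E)

lemma d_one_apply (c : Cochain ρ S 1) (s : LiftedSimplex x₀ S 2) :
    (d ρ S 1 c).1 s = c.1 (s.face 0) - c.1 (s.face 1) + c.1 (s.face 2) := by
  change ∑ i : Fin 3, (-1 : k) ^ (i : ℕ) • c.1 (s.face i) = _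
  simp [Fin.sum_univ_three, sub_eq_add_neg]

lemma d_two_apply (c : Cochain ρ S 2) (s : LiftedSimplex x₀ S 3) :
    (d ρ S 2 c).1 s =
      c.1 (s.face 0) - c.1 (s.face 1) + c.1 (s.face 2) - c.1 (s.face 3) := by
  change ∑ i : Fin 4, (-1 : k) ^ (i : ℕ) • c.1 (s.face i) = _
  simp [Fin.sum_univ_four, sub_eq_add_neg, pow_succ]

variable {ρ} in
lemma cocycle_simplex {V : Type*} [AddCommGroup V] [Module ℝ V] [TopologicalSpace V]
    [IsTopologicalAddGroup V] [ContinuousSMul ℝ V] {C : Set V} (hC : Convex ℝ C)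
    {z : Cochain ρ S 2} (hz : d ρ S 2 z = 0) (F : LiftedMap x₀ S C) (a b c e : C) :
    z.1 (F.simplex hC ![b, c, e]) - z.1 (F.simplex hC ![a, c, e]) +
      z.1 (F.simplex hC ![a, b, e]) - z.1 (F.simplex hC ![a, b, c]) = 0 := by
  have h := congrArg (fun x : Cochain ρ S 3 => x.1 (F.simplex hC ![a, b, c, e])) hz
  simp only [d_two_apply, LiftedMap.face_simplex] at h
  have h0 : ![a, b, c, e] ∘ (0 : Fin 4).succAbove = ![b, c, e] := by ext i; fin_cases i <;> rfl
  have h1 : ![a, b, c, e] ∘ (1 : Fin 4).succAbove = ![a, c, e] := by ext i; fin_cases i <;> rfl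
  have h2 : ![a, b, c, e] ∘ (2 : Fin 4).succAbove = ![a, b, e] := by ext i; fin_cases i <;> rfl
  have h3 : ![a, b, c, e] ∘ (3 : Fin 4).succAbove = ![a, b, c] := by ext i; fin_cases i <;> rfl
  rw [h0, h1, h2, h3] at h
  exact h

variable (F : C(T × unitInterval, T)) (hF : ∀ x, F (x, 0) = x)

/-- The prism operator on `2`-cochains. -/
noncomputable def prismOp (z : Cochain ρ T 2) : Cochain ρ T 1 :=
  ⟨fun s => z.1 ((s.prism F hF).simplex (convex_prismSet _)
        ![prismPt (stdSimplex.vertex 0) 0, prismPt (stdSimplex.vertex 1) 0,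
          prismPt (stdSimplex.vertex 1) 1]) -
      z.1 ((s.prism F hF).simplex (convex_prismSet _)
        ![prismPt (stdSimplex.vertex 0) 0, prismPt (stdSimplex.vertex 0) 1,
          prismPt (stdSimplex.vertex 1) 1]), fun g s => by
    simp only [LiftedSimplex.prism_deck, LiftedMap.simplex_deck, z.2 g, map_sub]⟩

lemma d_prismOp {z : Cochain ρ T 2} (hz : d ρ T 2 z = 0) (s : LiftedSimplex x₀ T 2) :
    (d ρ T 1 (prismOp ρ F hF z)).1 s = z.1 s - z.1 (s.homotopyEnd F hF) := by
  have hs := s.simplex_prism_zero F hF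
  have h0 : (fun i => prismPt (stdSimplex.vertex i) 0 : Fin 3 → prismSet 2) =
      ![prismPt (stdSimplex.vertex 0) 0, prismPt (stdSimplex.vertex 1) 0,
        prismPt (stdSimplex.vertex 2) 0] := by ext1 i; fin_cases i <;> rfl
  have h1 : (fun i => prismPt (stdSimplex.vertex i) 1 : Fin 3 → prismSet 2) =
      ![prismPt (stdSimplex.vertex 0) 1, prismPt (stdSimplex.vertex 1) 1,
        prismPt (stdSimplex.vertex 2) 1] := by ext1 i; fin_cases i <;> rfl
  rw [h0] at hs
  conv_rhs => rw [← hs, LiftedSimplex.homotopyEnd, h1, hs]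
  rw [d_one_apply]
  simp only [prismOp, LiftedSimplex.simplex_prism_face]
  have hv : ∀ (i : Fin 3) (a b c : prismSet 1), prismFace i ∘ ![a, b, c] =
      ![prismFace i a, prismFace i b, prismFace i c] := by
    intro i a b c; ext1 j; fin_cases j <;> rfl
  simp only [hv, prismFace_prismPt]
  have e00 : (0 : Fin 3).succAbove (0 : Fin 2) = 1 := rfl
  have e01 : (0 : Fin 3).succAbove (1 : Fin 2) = 2 := rfl
  have e10 : (1 : Fin 3).succAbove (0 : Fin 2) = 0 := rfl
  have e11 : (1 : Fin 3).succAbove (1 : Fin 2) = 2 := rfl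
  have e20 : (2 : Fin 3).succAbove (0 : Fin 2) = 0 := rfl
  have e21 : (2 : Fin 3).succAbove (1 : Fin 2) = 1 := rfl
  rw [e00, e01, e10, e11, e20, e21]
  -- The prism over the triangle is cut into three tetrahedra. In the combination `T1 - T2 + T3`
  -- their inner faces cancel, which leaves the bottom, the top and two triangles over each edge.
  have T1 := cocycle_simplex (convex_prismSet _) hz (s.prism F hF)
    (prismPt (stdSimplex.vertex 0) 0) (prismPt (stdSimplex.vertex 1) 0)
    (prismPt (stdSimplex.vertex 2) 0) (prismPt (stdSimplex.vertex 2) 1)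
  have T2 := cocycle_simplex (convex_prismSet _) hz (s.prism F hF)
    (prismPt (stdSimplex.vertex 0) 0) (prismPt (stdSimplex.vertex 1) 0)
    (prismPt (stdSimplex.vertex 1) 1) (prismPt (stdSimplex.vertex 2) 1)
  have T3 := cocycle_simplex (convex_prismSet _) hz (s.prism F hF)
    (prismPt (stdSimplex.vertex 0) 0) (prismPt (stdSimplex.vertex 0) 1)
    (prismPt (stdSimplex.vertex 1) 1) (prismPt (stdSimplex.vertex 2) 1)
  rw [hs] at T1
  have alg : ∀ {p a b c e f g q r t : E}, a - b + c - p = 0 → e - f + c - g = 0 →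
      q - f + r - t = 0 → a - e - (b - r) + (g - t) = p - q := by
    intro p a b c e f g q r t h1 h2 h3
    rw [← sub_eq_zero]
    have h := congrArg₂ (· + ·) (congrArg₂ (· - ·) h1 h2) h3
    simp only [sub_zero, add_zero] at h
    rw [← h]
    abel
  exact alg T1 T2 T3

end Cochains

/-! ### Subdivided segments and local primitives -/

section Subdivision

/-- The point `i / N` of the unit interval. -/
noncomputable def divPt (N i : ℕ) : unitInterval := Set.projIcc 0 1 zero_le_one ((i : ℝ) / N)

lemma divPt_zero (N : ℕ) : divPt N 0 = 0 := by
  simp [divPt]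

lemma divPt_self {N : ℕ} (hN : 0 < N) : divPt N N = 1 := by
  have : (N : ℝ) ≠ 0 := by positivity
  rw [divPt, div_self this]
  simp

lemma dist_divPt_le (N i : ℕ) : |(divPt N i : ℝ) - divPt N (i + 1)| ≤ 1 / N := by
  have h := (LipschitzWith.projIcc (zero_le_one (α := ℝ))).dist_le_mul ((i : ℝ) / N)
    (((i + 1 : ℕ) : ℝ) / N)
  rw [Subtype.dist_eq, Real.dist_eq, Real.dist_eq, NNReal.coe_one, one_mul] at h
  refine h.trans (le_of_eq ?_)
  rw [← sub_div, abs_div, Nat.abs_cast]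
  simp

variable {V : Type*} [NormedAddCommGroup V] [NormedSpace ℝ V] {C : Set V}

/-- The point `(1 - t) a + t b` of a convex set. -/
def linePt (hC : Convex ℝ C) (a b : C) (t : unitInterval) : C :=
  ⟨(1 - (t : ℝ)) • (a : V) + (t : ℝ) • (b : V),
    hC a.2 b.2 (sub_nonneg.2 t.2.2) t.2.1 (by ring)⟩

lemma linePt_zero (hC : Convex ℝ C) (a b : C) : linePt hC a b 0 = a := by
  ext; simp [linePt]

lemma linePt_one (hC : Convex ℝ C) (a b : C) : linePt hC a b 1 = b := by
  ext; simp [linePt]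

lemma dist_linePt_left (hC : Convex ℝ C) (a b : C) (s t : unitInterval) :
    dist (linePt hC a b s) (linePt hC a b t) = |(s : ℝ) - t| * dist a b := by
  rw [Subtype.dist_eq, Subtype.dist_eq, dist_eq_norm, dist_eq_norm, ← Real.norm_eq_abs,
    ← norm_neg, ← norm_smul]
  congr 1
  simp only [linePt]
  module

lemma dist_linePt_right (hC : Convex ℝ C) (a b c : C) (t : unitInterval) :
    dist (linePt hC a b t) (linePt hC a c t) ≤ dist b c := by
  have h : dist (linePt hC a b t) (linePt hC a c t) = |(t : ℝ)| * dist b c := by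
    rw [Subtype.dist_eq, Subtype.dist_eq, dist_eq_norm, dist_eq_norm, ← Real.norm_eq_abs,
      ← norm_smul]
    congr 1
    simp only [linePt]
    module
  rw [h, abs_of_nonneg t.2.1]
  exact mul_le_of_le_one_left dist_nonneg t.2.2

/-- The bound depends only on `D` and `ε`, so one `N` serves all segments of length at most `D`; two
neighbouring segments can thus be compared piece by piece. -/
lemma eventually_dist_linePt_lt (hC : Convex ℝ C) {D ε : ℝ} (hε : 0 < ε) :
    ∀ᶠ N : ℕ in Filter.atTop, 0 < N ∧ ∀ a b : C, dist a b ≤ D → ∀ i,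
      dist (linePt hC a b (divPt N i)) (linePt hC a b (divPt N (i + 1))) < ε := by
  have h : Filter.Tendsto (fun N : ℕ => 1 / (N : ℝ) * D) Filter.atTop (𝓝 (0 * D)) :=
    tendsto_one_div_atTop_nhds_zero_nat.mul_const D
  rw [zero_mul] at h
  filter_upwards [h.eventually_lt_const hε, Filter.eventually_gt_atTop 0] with N hN hN0
  refine ⟨hN0, fun a b hab i => ?_⟩
  rw [dist_linePt_left]
  exact (mul_le_mul (dist_divPt_le N i) hab dist_nonneg (by positivity)).trans_lt hN

lemma aff_mem_ball (hC : Convex ℝ C) {m : ℕ} (q : Fin (m + 1) → C) (p : C) (δ : ℝ)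
    (hq : ∀ i, dist (q i) p < δ) (t : Simp m) : dist (aff hC q t) p < δ :=
  Metric.mem_ball.1 <| (convex_ball (p : V) δ).sum_mem (fun j _ => t.2.1 j) t.2.2 fun j _ =>
    Metric.mem_ball.2 (hq j)

variable {E : Type*} [AddCommGroup E]

/-- A function of two variables on a bounded convex set that is additive on small triangles is
locally the difference of the values of a function. -/
lemma exists_local_primitive (hC : Convex ℝ C) {D : ℝ} (hD : ∀ a b : C, dist a b ≤ D) (c : C)
    {δ : ℝ} (hδ : 0 < δ) (f : C → C → E)
    (hf : ∀ p q r, dist p q < δ → dist p r < δ → f q r - f p r + f p q = 0) :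
    ∃ Y : C → E, ∀ p q, dist p q < δ / 2 → f p q = Y q - Y p := by
  obtain ⟨N, hN0, hN⟩ := (eventually_dist_linePt_lt hC (D := D) (half_pos hδ)).exists
  have hadd : ∀ p q r, dist p q < δ → dist p r < δ → f p q + f q r = f p r := by
    intro p q r h1 h2
    rw [← sub_eq_zero, ← hf p q r h1 h2]
    abel
  have hzero : ∀ p, f p p = 0 := by
    intro p
    simpa using hf p p p (by simpa) (by simpa)
  let x (p : C) (i : ℕ) : C := linePt hC c p (divPt N i)
  -- The value `Y p` is the sum of `f` along the subdivided segment from `c` to `p`. For close `p`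
  -- and `q` the two segments are the sides of a ladder that starts at `c`; each rung is cut by a
  -- diagonal into small triangles, on which `f` is additive.
  have ladder : ∀ p q, dist p q < δ / 2 → ∀ m,
      ∑ i ∈ Finset.range m, f (x p i) (x p (i + 1)) + f (x p m) (x q m) =
        ∑ i ∈ Finset.range m, f (x q i) (x q (i + 1)) := by
    intro p q hpq m
    induction m with
    | zero =>
      simp only [Finset.range_zero, Finset.sum_empty, zero_add, x, divPt_zero, linePt_zero, hzero]
    | succ m ih =>
      rw [Finset.sum_range_succ, Finset.sum_range_succ, ← ih, add_assoc, add_assoc]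
      congr 1
      have h1 : dist (x p m) (x p (m + 1)) < δ / 2 := hN c p (hD c p) m
      have h2 : dist (x q m) (x q (m + 1)) < δ / 2 := hN c q (hD c q) m
      have h3 : ∀ i, dist (x p i) (x q i) < δ / 2 := fun i =>
        (dist_linePt_right hC c p q _).trans_lt hpq
      have h4 : dist (x p m) (x q (m + 1)) < δ := by
        linarith [dist_triangle (x p m) (x q m) (x q (m + 1)), h3 m]
      rw [hadd _ _ _ (by linarith) h4, hadd _ _ _ (by linarith [h3 m]) h4]
  refine ⟨fun p => ∑ i ∈ Finset.range N, f (x p i) (x p (i + 1)), fun p q hpq => ?_⟩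
  have h := ladder p q hpq N
  simp only [x, divPt_self hN0, linePt_one] at h ⊢
  rw [← h]
  abel

lemma eventually_sum_eq (hC : Convex ℝ C) {f : C → C → E} {Y : C → E} {ε : ℝ} (hε : 0 < ε)
    (hY : ∀ p q, dist p q < ε → f p q = Y q - Y p) (a b : C) :
    ∀ᶠ N : ℕ in Filter.atTop, ∑ i ∈ Finset.range N,
      f (linePt hC a b (divPt N i)) (linePt hC a b (divPt N (i + 1))) = Y b - Y a := by
  filter_upwards [eventually_dist_linePt_lt hC (D := dist a b) hε] with N hN
  rw [Finset.sum_congr rfl fun i _ => hY _ _ (hN.2 a b le_rfl i),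
    Finset.sum_range_sub (fun i => Y (linePt hC a b (divPt N i))), divPt_self hN.1, divPt_zero,
    linePt_one, linePt_zero]

end Subdivision

/-! ### Cocycles that vanish on small simplices -/

section Local

variable {X : Type*} [TopologicalSpace X] {x₀ : X} {T : Set X} {n : ℕ}
variable {k : Type*} [CommRing k] {E : Type*} [AddCommGroup E] [Module k E]
variable {ρ : Representation k (FundamentalGroup X x₀) E}

/-- The value of a `2`-cochain on the triangle with vertices `p`, `q`, `r` in a lifted simplex. -/
noncomputable def onTriangle (z : Cochain ρ T 2) (s : LiftedSimplex x₀ T n) (p q r : Simp n) : E :=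
  z.1 (s.toLiftedMap.simplex (convex_stdSimplex ℝ _) ![p, q, r])

lemma onTriangle_deck (z : Cochain ρ T 2) (g : FundamentalGroup X x₀) (s : LiftedSimplex x₀ T n)
    (p q r : Simp n) : onTriangle z (s.deck g) p q r = ρ g (onTriangle z s p q r) :=
  (congrArg z.1 (LiftedMap.simplex_deck g s.toLiftedMap _ _)).trans (z.2 g _)

lemma onTriangle_face (z : Cochain ρ T 2) (s : LiftedSimplex x₀ T (n + 1)) (i : Fin (n + 2))
    (p q r : Simp n) : onTriangle z (s.face i) p q r =
      onTriangle z s (faceMap i p) (faceMap i q) (faceMap i r) := by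
  rw [onTriangle, LiftedSimplex.simplex_toLiftedMap_face]
  have : faceMap i ∘ ![p, q, r] = ![faceMap i p, faceMap i q, faceMap i r] := by
    ext1 j; fin_cases j <;> rfl
  rw [this, onTriangle]

lemma onTriangle_vertex (z : Cochain ρ T 2) (s : LiftedSimplex x₀ T 2) :
    onTriangle z s (stdSimplex.vertex 0) (stdSimplex.vertex 1) (stdSimplex.vertex 2) = z.1 s := by
  have h : (fun i => stdSimplex.vertex i : Fin 3 → Simp 2) =
      ![stdSimplex.vertex 0, stdSimplex.vertex 1, stdSimplex.vertex 2] := by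
    ext1 i; fin_cases i <;> rfl
  have hs := s.simplex_toLiftedMap
  rw [h] at hs
  rw [onTriangle, hs]

lemma onTriangle_cocycle {z : Cochain ρ T 2} (hz : d ρ T 2 z = 0) (s : LiftedSimplex x₀ T n)
    (o p q r : Simp n) : onTriangle z s p q r =
      onTriangle z s o q r - onTriangle z s o p r + onTriangle z s o p q := by
  rw [← sub_eq_zero, ← cocycle_simplex (convex_stdSimplex ℝ _) hz s.toLiftedMap o p q r]
  simp only [onTriangle]
  abel

/-- A cochain that vanishes on the simplices that are subordinate to an open cover vanishes on
small triangles. -/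
lemma exists_onTriangle_eq_zero {ι : Type*} {U : ι → Set X} (hU : ∀ i, IsOpen (U i))
    (hT : T ⊆ ⋃ i, U i) {z : Cochain ρ T 2}
    (hzU : ∀ i, ∀ s : LiftedSimplex x₀ T 2, (∀ t, s.map t ∈ U i) → z.1 s = 0)
    (s : LiftedSimplex x₀ T n) :
    ∃ δ > 0, ∀ p q r, dist p q < δ → dist p r < δ → onTriangle z s p q r = 0 := by
  -- A Lebesgue number of the pulled back cover works: balls are convex, so a triangle with vertices
  -- near `p` stays in the ball around `p`.
  obtain ⟨δ, hδ, h⟩ := lebesgue_number_lemma_of_metric (s := (Set.univ : Set (Simp n)))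
    (c := fun i => s.map ⁻¹' U i) isCompact_univ (fun i => (hU i).preimage s.map.continuous)
    (fun x _ => by
      obtain ⟨i, hi⟩ := Set.mem_iUnion.1 (hT (s.mem x))
      exact Set.mem_iUnion.2 ⟨i, hi⟩)
  refine ⟨δ, hδ, fun p q r hq hr => ?_⟩
  obtain ⟨i, hi⟩ := h p trivial
  have hv : ∀ j, dist ((![p, q, r] : Fin 3 → Simp n) j) p < δ := by
    intro j
    match j with
    | 0 => exact (dist_self p).trans_lt hδ
    | 1 => exact (dist_comm q p).trans_lt hq
    | 2 => exact (dist_comm r p).trans_lt hr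
  exact hzU i _ fun t => hi (Metric.mem_ball.2 (aff_mem_ball _ _ p δ hv t))

/-- Where `z` vanishes on the triangle `p`, `q`, `r`, the cocycle condition on the tetrahedron with
apex `o` says that `onTriangle z s o` is additive there, so `exists_local_primitive` applies. -/
lemma exists_onTriangle_primitive {ι : Type*} {U : ι → Set X} (hU : ∀ i, IsOpen (U i))
    (hT : T ⊆ ⋃ i, U i) {z : Cochain ρ T 2} (hz : d ρ T 2 z = 0)
    (hzU : ∀ i, ∀ s : LiftedSimplex x₀ T 2, (∀ t, s.map t ∈ U i) → z.1 s = 0)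
    (s : LiftedSimplex x₀ T n) (o : Simp n) :
    ∃ Y : Simp n → E, ∃ ε > 0, ∀ p q, dist p q < ε → onTriangle z s o p q = Y q - Y p := by
  obtain ⟨δ, hδ, h⟩ := exists_onTriangle_eq_zero hU hT hzU s
  obtain ⟨Y, hY⟩ := exists_local_primitive (convex_stdSimplex ℝ (Fin (n + 1)))
    (D := Metric.diam (Set.univ : Set (Simp n)))
    (fun a b => Metric.dist_le_diam_of_mem isCompact_univ.isBounded trivial trivial) o hδ
    (onTriangle z s o) fun p q r hq hr => by
      rw [← onTriangle_cocycle hz, h p q r hq hr]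
  exact ⟨Y, δ / 2, half_pos hδ, hY⟩

/-- The sum of the values of a `2`-cochain on the triangles given by the initial point of a path
and the pieces of its subdivision into `N` parts. -/
noncomputable def fanSum (z : Cochain ρ T 2) (s : LiftedSimplex x₀ T 1) (N : ℕ) : E :=
  ∑ i ∈ Finset.range N, onTriangle z s (stdSimplex.vertex 0)
    (linePt (convex_stdSimplex ℝ _) (stdSimplex.vertex 0) (stdSimplex.vertex 1) (divPt N i))
    (linePt (convex_stdSimplex ℝ _) (stdSimplex.vertex 0) (stdSimplex.vertex 1) (divPt N (i + 1)))

open Classical in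
/-- The value of `fanSum` for fine subdivisions. -/
noncomputable def fanLimit (z : Cochain ρ T 2) (s : LiftedSimplex x₀ T 1) : E :=
  if h : ∃ e, ∀ᶠ N in Filter.atTop, fanSum z s N = e then h.choose else 0

lemma fanLimit_eq {z : Cochain ρ T 2} {s : LiftedSimplex x₀ T 1} {e : E}
    (h : ∀ᶠ N in Filter.atTop, fanSum z s N = e) : fanLimit z s = e := by
  have h' : ∃ e, ∀ᶠ N in Filter.atTop, fanSum z s N = e := ⟨e, h⟩
  rw [fanLimit, dif_pos h']
  obtain ⟨N, h1, h2⟩ := (h'.choose_spec.and h).exists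
  exact h1.symm.trans h2

lemma fanSum_deck (z : Cochain ρ T 2) (g : FundamentalGroup X x₀) (s : LiftedSimplex x₀ T 1)
    (N : ℕ) : fanSum z (s.deck g) N = ρ g (fanSum z s N) := by
  simp only [fanSum, onTriangle_deck, map_sum]

lemma faceMap_linePt (i : Fin (n + 2)) (a b : Simp n) (t : unitInterval) :
    faceMap i (linePt (convex_stdSimplex ℝ _) a b t) =
      linePt (convex_stdSimplex ℝ _) (faceMap i a) (faceMap i b) t := by
  apply Subtype.ext
  change FunOnFinite.linearMap ℝ ℝ i.succAbove ((1 - (t : ℝ)) • a.1 + (t : ℝ) • b.1) = _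
  rw [map_add, map_smul, map_smul]
  rfl

/-- The cocycle condition moves the apex of each thin triangle from the initial vertex of the edge
to `o`. The triangles with apex `o` over the pieces sum to a difference of values of `Y`, and the
correction terms telescope. -/
lemma eventually_fanSum_face {z : Cochain ρ T 2} (hz : d ρ T 2 z = 0)
    (s : LiftedSimplex x₀ T 2) (o : Simp 2) {Y : Simp 2 → E} {ε : ℝ} (hε : 0 < ε)
    (hY : ∀ p q, dist p q < ε → onTriangle z s o p q = Y q - Y p) (i : Fin 3) :
    ∀ᶠ N in Filter.atTop, fanSum z (s.face i) N =
      Y (stdSimplex.vertex (i.succAbove 1)) - Y (stdSimplex.vertex (i.succAbove 0)) -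
        onTriangle z s o (stdSimplex.vertex (i.succAbove 0))
          (stdSimplex.vertex (i.succAbove 1)) := by
  set p : Simp 2 := stdSimplex.vertex (i.succAbove 0) with hp
  set q : Simp 2 := stdSimplex.vertex (i.succAbove 1) with hq
  have hfp : faceMap i (stdSimplex.vertex 0) = p := stdSimplex.map_vertex _ _
  have hfq : faceMap i (stdSimplex.vertex 1) = q := stdSimplex.map_vertex _ _
  have hpp : onTriangle z s o p p = 0 := by rw [hY p p (by simpa), sub_self]
  filter_upwards [eventually_sum_eq (convex_stdSimplex ℝ _) hε hY p q,
    Filter.eventually_gt_atTop 0] with N hN hN0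
  simp only [fanSum, onTriangle_face, faceMap_linePt, hfp, hfq]
  rw [← hN]
  have htel := Finset.sum_range_sub (fun i => onTriangle z s o p
    (linePt (convex_stdSimplex ℝ _) p q (divPt N i))) N
  rw [divPt_self hN0, divPt_zero, linePt_one, linePt_zero, hpp, sub_zero] at htel
  rw [← htel, ← Finset.sum_sub_distrib]
  refine Finset.sum_congr rfl fun j _ => ?_
  rw [onTriangle_cocycle hz s o p]
  abel

/-- A `2`-cocycle that vanishes on the simplices that are subordinate to an open cover is a
coboundary. -/
theorem exists_d_eq_of_vanishing {ι : Type*} {U : ι → Set X} (hU : ∀ i, IsOpen (U i))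
    (hT : T ⊆ ⋃ i, U i) {z : Cochain ρ T 2} (hz : d ρ T 2 z = 0)
    (hzU : ∀ i, ∀ s : LiftedSimplex x₀ T 2, (∀ t, s.map t ∈ U i) → z.1 s = 0) :
    ∃ w : Cochain ρ T 1, d ρ T 1 w = z := by
  -- A primitive `Y` only shows that the fan sums stabilise; it does not enter their definition.
  -- Equivariance therefore passes from the fan sums to the limit.
  have hw : ∀ g s, fanLimit z (s.deck g) = ρ g (fanLimit z s) := by
    intro g s
    obtain ⟨Y, ε, hε, hY⟩ := exists_onTriangle_primitive hU hT hz hzU s (stdSimplex.vertex 0)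
    have h := eventually_sum_eq (convex_stdSimplex ℝ _) hε hY (stdSimplex.vertex 0)
      (stdSimplex.vertex 1)
    rw [fanLimit_eq h]
    refine fanLimit_eq ?_
    filter_upwards [h] with N hN
    rw [fanSum_deck, ← hN]
    rfl
  let w : Cochain ρ T 1 := ⟨fanLimit z, hw⟩
  -- In the alternating sum over the three faces the values of `Y` cancel, and the terms with apex
  -- `o` add up to minus the value of `z`; hence the sign.
  refine ⟨-w, ?_⟩
  rw [map_neg, neg_eq_iff_eq_neg]
  refine Subtype.ext (funext fun s => ?_)
  change (d ρ T 1 w).1 s = -z.1 s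
  obtain ⟨Y, ε, hε, hY⟩ := exists_onTriangle_primitive hU hT hz hzU s (stdSimplex.vertex 0)
  rw [d_one_apply, ← onTriangle_vertex, onTriangle_cocycle hz s (stdSimplex.vertex 0)]
  change fanLimit z (s.face 0) - fanLimit z (s.face 1) + fanLimit z (s.face 2) = _
  rw [fanLimit_eq (eventually_fanSum_face hz s _ hε hY 0),
    fanLimit_eq (eventually_fanSum_face hz s _ hε hY 1),
    fanLimit_eq (eventually_fanSum_face hz s _ hε hY 2)]
  have e00 : (0 : Fin 3).succAbove (0 : Fin 2) = 1 := rfl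
  have e01 : (0 : Fin 3).succAbove (1 : Fin 2) = 2 := rfl
  have e10 : (1 : Fin 3).succAbove (0 : Fin 2) = 0 := rfl
  have e11 : (1 : Fin 3).succAbove (1 : Fin 2) = 2 := rfl
  have e20 : (2 : Fin 3).succAbove (0 : Fin 2) = 0 := rfl
  have e21 : (2 : Fin 3).succAbove (1 : Fin 2) = 1 := rfl
  rw [e00, e01, e10, e11, e20, e21]
  abel

end Local

/-! ### Extension of cochains by zero -/

section ExtendByZero

variable {X : Type*} [TopologicalSpace X] {x₀ : X} {S T : Set X} {n : ℕ}
variable {k : Type*} [CommRing k] {E : Type*} [AddCommGroup E] [Module k E]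
variable {ρ : Representation k (FundamentalGroup X x₀) E}

/-- A lifted simplex with image in `S` as a lifted simplex over `S`. -/
def LiftedSimplex.codRestrict (s : LiftedSimplex x₀ T n) (h : ∀ t, s.map t ∈ S) :
    LiftedSimplex x₀ S n where
  map := s.map
  mem := h
  lift := s.lift

open Classical in
/-- The values of the extension by zero of a cochain on `S` to a cochain on `T`. -/
noncomputable def extendZeroFun (y : Cochain ρ S n) (s : LiftedSimplex x₀ T n) : E :=
  if h : ∀ t, s.map t ∈ S then y.1 (s.codRestrict h) else 0

lemma extendZeroFun_deck (y : Cochain ρ S n) (g : FundamentalGroup X x₀)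
    (s : LiftedSimplex x₀ T n) : extendZeroFun y (s.deck g) = ρ g (extendZeroFun y s) := by
  by_cases h : ∀ t, s.map t ∈ S
  · have h' : ∀ t, (s.deck g).map t ∈ S := h
    rw [extendZeroFun, extendZeroFun, dif_pos h, dif_pos h']
    exact y.2 g (s.codRestrict h)
  · have h' : ¬ ∀ t, (s.deck g).map t ∈ S := h
    rw [extendZeroFun, extendZeroFun, dif_neg h, dif_neg h', map_zero]

variable (T) in
/-- The extension by zero of a cochain on `S` to a cochain on `T`. -/
noncomputable def extendZero (y : Cochain ρ S n) : Cochain ρ T n :=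
  ⟨extendZeroFun y, extendZeroFun_deck y⟩

lemma extendZero_apply (y : Cochain ρ S n) (s : LiftedSimplex x₀ T n) (h : ∀ t, s.map t ∈ S) :
    (extendZero T y).1 s = y.1 (s.codRestrict h) :=
  dif_pos h

lemma extendZero_apply_of_not (y : Cochain ρ S n) (s : LiftedSimplex x₀ T n)
    (h : ¬ ∀ t, s.map t ∈ S) : (extendZero T y).1 s = 0 :=
  dif_neg h

lemma d_extendZero_apply (y : Cochain ρ S n) (s : LiftedSimplex x₀ T (n + 1))
    (h : ∀ t, s.map t ∈ S) :
    (d ρ T n (extendZero T y)).1 s = (d ρ S n y).1 (s.codRestrict h) := by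
  change ∑ i : Fin (n + 2), (-1 : k) ^ (i : ℕ) • (extendZero T y).1 (s.face i) =
    ∑ i : Fin (n + 2), (-1 : k) ^ (i : ℕ) • y.1 ((s.codRestrict h).face i)
  refine Finset.sum_congr rfl fun i _ => ?_
  rw [extendZero_apply y (s.face i) fun t => h (faceMap i t)]
  rfl

/-- If `T` can be deformed in itself into `S`, a `2`-cocycle on `T` that is a coboundary on `S` is
a coboundary. -/
theorem exists_d_eq_of_homotopy (F : C(T × unitInterval, T)) (hF : ∀ x, F (x, 0) = x)
    (hFS : ∀ x, (F (x, 1) : X) ∈ S) {z : Cochain ρ T 2} (hz : d ρ T 2 z = 0) (y : Cochain ρ S 1)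
    (hy : ∀ (s : LiftedSimplex x₀ T 2) (h : ∀ t, s.map t ∈ S),
      z.1 s = (d ρ S 1 y).1 (s.codRestrict h)) :
    ∃ u : Cochain ρ T 1, d ρ T 1 u = z := by
  -- Subtracting this coboundary makes the cocycle vanish on all simplices in `S`, in particular on
  -- the ends of all prisms. The prism operator is then a primitive of the difference.
  set z' : Cochain ρ T 2 := z - d ρ T 1 (extendZero T y) with hz'
  have hdz' : d ρ T 2 z' = 0 := by rw [hz', map_sub, hz, d_d, sub_zero]
  refine ⟨prismOp ρ F hF z' + extendZero T y, ?_⟩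
  rw [map_add, ← eq_sub_iff_add_eq, ← hz']
  refine Subtype.ext (funext fun s => ?_)
  refine (d_prismOp ρ F hF hdz' s).trans ?_
  have h : ∀ t, (s.homotopyEnd F hF).map t ∈ S := fun t => by
    rw [LiftedSimplex.homotopyEnd_map]
    exact hFS _
  have h0 : z'.1 (s.homotopyEnd F hF) = 0 := by
    change z.1 (s.homotopyEnd F hF) - (d ρ T 1 (extendZero T y)).1 (s.homotopyEnd F hF) = 0
    rw [hy _ h, d_extendZero_apply y _ h, sub_self]
  rw [h0, sub_zero]

end ExtendByZero

variable {X : Type*} [TopologicalSpace X] {x₀ : X} {S T : Set X} {n : ℕ}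
variable {k : Type*} [CommRing k] {E : Type*} [AddCommGroup E] [Module k E]
variable {ρ : Representation k (FundamentalGroup X x₀) E}

lemma cls_eq_zero_iff {z : cocycles ρ S (n + 1)} :
    cls ρ z = 0 ↔ ∃ w, d ρ S n w = z.1 :=
  (Submodule.Quotient.mk_eq_zero _).trans Iff.rfl

lemma cls_surjective (b : H ρ S n) : ∃ y : cocycles ρ S n, cls ρ y = b :=
  Submodule.Quotient.mk_surjective _ b

lemma d_coe_cocycle (z : cocycles ρ S n) : d ρ S n z.1 = 0 := z.2

lemma res_cls (h : S ⊆ T) (z : cocycles ρ T n) : res ρ h n (cls ρ z) = cls ρ (resCocycle ρ h n z) :=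
  rfl

lemma resCochain_extendZero (h : S ⊆ T) (y : Cochain ρ S n) :
    resCochain ρ h n (extendZero T y) = y :=
  Subtype.ext (funext fun s => extendZero_apply y (s.incl h) s.mem)

/-- For `S' ∩ S ⊆ C ⊆ S`, the extensions by zero of a cochain on `S` and of its restriction to `C`
agree on the simplices of `S'`. -/
lemma extendZero_resCochain_apply {C S' : Set X} (hC : C ⊆ S) (hS : S' ∩ S ⊆ C)
    (y : Cochain ρ S n) (s : LiftedSimplex x₀ T n) (hs : ∀ t, s.map t ∈ S') :
    (extendZero T (resCochain ρ hC n y)).1 s = (extendZero T y).1 s := by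
  by_cases h : ∀ t, s.map t ∈ S
  · have hC' : ∀ t, s.map t ∈ C := fun t => hS ⟨hs t, h t⟩
    rw [extendZero_apply _ s h, extendZero_apply _ s hC']
    rfl
  · have hC' : ¬ ∀ t, s.map t ∈ C := fun h' => h fun t => hC (h' t)
    rw [extendZero_apply_of_not _ s h, extendZero_apply_of_not _ s hC']

/-- If the values of two cochains on the simplices of `S` agree, so do those of their
coboundaries. -/
lemma d_apply_congr {a b : Cochain ρ T n}
    (hab : ∀ s : LiftedSimplex x₀ T n, (∀ t, s.map t ∈ S) → a.1 s = b.1 s)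
    (s : LiftedSimplex x₀ T (n + 1)) (hs : ∀ t, s.map t ∈ S) :
    (d ρ T n a).1 s = (d ρ T n b).1 s := by
  change ∑ i : Fin (n + 2), (-1 : k) ^ (i : ℕ) • a.1 (s.face i) =
    ∑ i : Fin (n + 2), (-1 : k) ^ (i : ℕ) • b.1 (s.face i)
  exact Finset.sum_congr rfl fun i _ => by rw [hab (s.face i) fun t => hs (faceMap i t)]

/-! ### The Mayer–Vietoris connecting relation -/

section MayerVietoris

variable {A B C : Set X} {hA : C ⊆ A} {hB : C ⊆ B}

lemma IsConnecting.add {b b' : H ρ C n} {c c' : H ρ Set.univ (n + 1)}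
    (h : IsConnecting ρ hA hB b c) (h' : IsConnecting ρ hA hB b' c') :
    IsConnecting ρ hA hB (b + b') (c + c') := by
  obtain ⟨y, z, u, v, rfl, rfl, h1, h2, h3⟩ := h
  obtain ⟨y', z', u', v', rfl, rfl, h1', h2', h3'⟩ := h'
  refine ⟨y + y', z + z', u + u', v + v', rfl, rfl, ?_, ?_, ?_⟩
  · rw [map_add, map_add, add_sub_add_comm, h1, h1']; rfl
  · rw [map_add, ← h2, ← h2', ← map_add]; rfl
  · rw [map_add, ← h3, ← h3', ← map_add]; rfl

lemma IsConnecting.smul (r : k) {b : H ρ C n} {c : H ρ Set.univ (n + 1)}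
    (h : IsConnecting ρ hA hB b c) : IsConnecting ρ hA hB (r • b) (r • c) := by
  obtain ⟨y, z, u, v, rfl, rfl, h1, h2, h3⟩ := h
  refine ⟨r • y, r • z, r • u, r • v, rfl, rfl, ?_, ?_, ?_⟩
  · rw [map_smul, map_smul, ← smul_sub, h1]; rfl
  · rw [map_smul, ← h2, ← map_smul]; rfl
  · rw [map_smul, ← h3, ← map_smul]; rfl

lemma IsConnecting.sub {b b' : H ρ C n} {c c' : H ρ Set.univ (n + 1)}
    (h : IsConnecting ρ hA hB b c) (h' : IsConnecting ρ hA hB b' c') :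
    IsConnecting ρ hA hB (b - b') (c - c') := by
  have := h.add (h'.smul (-1))
  rwa [neg_one_smul, neg_one_smul, ← sub_eq_add_neg, ← sub_eq_add_neg] at this

/-- A class that vanishes on `A` and on `B` is in the image of the connecting homomorphism. -/
lemma exists_isConnecting (c : H ρ Set.univ (n + 1))
    (hcA : res ρ (Set.subset_univ A) (n + 1) c = 0)
    (hcB : res ρ (Set.subset_univ B) (n + 1) c = 0) :
    ∃ b, IsConnecting ρ hA hB b c := by
  obtain ⟨z, rfl⟩ := cls_surjective c
  rw [res_cls, cls_eq_zero_iff] at hcA hcB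
  obtain ⟨u, hu⟩ := hcA
  obtain ⟨v, hv⟩ := hcB
  refine ⟨_, ⟨resCochain ρ hA n u - resCochain ρ hB n v, ?_⟩, z, u, v, rfl, rfl, rfl, hu.symm,
    hv.symm⟩
  change d ρ C n _ = 0
  rw [map_sub, d_resCochain, d_resCochain, hu, hv, sub_eq_zero]
  rfl

/-- An element of the kernel of the connecting homomorphism comes from `M` and `B`, for
`C ⊆ M ⊆ A`. -/
lemma IsConnecting.mem_range {M : Set X} (hCM : C ⊆ M) (hMA : M ⊆ A) {b : H ρ C n}
    (h : IsConnecting ρ hA hB b 0) :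
    b ∈ LinearMap.range ((res ρ hCM n).coprod (-res ρ hB n)) := by
  obtain ⟨y, z, u, v, rfl, hz, h1, h2, h3⟩ := h
  obtain ⟨w, hw⟩ := cls_eq_zero_iff.1 hz
  have hu' : d ρ M n (resCochain ρ hMA n (u - resCochain ρ (Set.subset_univ A) n w)) = 0 := by
    rw [d_resCochain, map_sub, d_resCochain, hw, h2, sub_self, map_zero]
  have hv' : d ρ B n (v - resCochain ρ (Set.subset_univ B) n w) = 0 := by
    rw [map_sub, d_resCochain, hw, h3, sub_self]
  refine ⟨(cls ρ ⟨_, hu'⟩, cls ρ ⟨_, hv'⟩), ?_⟩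
  rw [LinearMap.coprod_apply, LinearMap.neg_apply, ← sub_eq_add_neg, res_cls, res_cls]
  change cls ρ (_ - _) = _
  congr 1
  apply Subtype.ext
  rw [← h1]
  change (resCochain ρ hA n u - resCochain ρ (Set.subset_univ C) n w) -
    (resCochain ρ hB n v - resCochain ρ (Set.subset_univ C) n w) = _
  exact sub_sub_sub_cancel_right _ _ _

/-- The elements that come from `M` and `B`, for `C ⊆ M ⊆ A`, are in the kernel of the connecting
homomorphism if the cocycles on `M` extend to `A`. -/
lemma isConnecting_zero_of_mem_range {M : Set X} (hCM : C ⊆ M) (hMA : M ⊆ A)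
    (hext : ∀ y : cocycles ρ M n, ∃ y' : cocycles ρ A n, resCochain ρ hMA n y'.1 = y.1)
    {b : H ρ C n} (h : b ∈ LinearMap.range ((res ρ hCM n).coprod (-res ρ hB n))) :
    IsConnecting ρ hA hB b 0 := by
  obtain ⟨⟨p, q⟩, rfl⟩ := h
  obtain ⟨p, rfl⟩ := cls_surjective p
  obtain ⟨q, rfl⟩ := cls_surjective q
  obtain ⟨p', hp'⟩ := hext p
  refine ⟨resCocycle ρ hCM n p - resCocycle ρ hB n q, 0, p'.1, q.1, ?_, rfl, ?_, ?_, ?_⟩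
  · rw [LinearMap.coprod_apply, LinearMap.neg_apply, ← sub_eq_add_neg]
    rfl
  · change _ = resCochain ρ hCM n p.1 - resCochain ρ hB n q.1
    rw [← hp']
    rfl
  · rw [d_coe_cocycle]; exact map_zero _
  · rw [d_coe_cocycle]; exact map_zero _

/-- If the cocycles that vanish on `A` and `B` are coboundaries, the class of the image of zero
under the connecting homomorphism vanishes. -/
lemma IsConnecting.eq_zero (hAB : A ∩ B ⊆ C)
    (hexc : ∀ z : Cochain ρ Set.univ (n + 2), d ρ _ _ z = 0 →
      resCochain ρ (Set.subset_univ A) _ z = 0 → resCochain ρ (Set.subset_univ B) _ z = 0 →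
      ∃ w, d ρ _ _ w = z)
    {c : H ρ Set.univ (n + 2)} (h : IsConnecting ρ hA hB (0 : H ρ C (n + 1)) c) : c = 0 := by
  obtain ⟨y, z, u, v, hy, rfl, h1, h2, h3⟩ := h
  obtain ⟨e, he⟩ := cls_eq_zero_iff.1 hy
  -- This changes `u` by a coboundary so that it agrees with `v` on `C`, without changing `d u`.
  set u' := u - d ρ A n (extendZero A e) with hu'
  have hu'C : resCochain ρ hA _ u' = resCochain ρ hB _ v := by
    rw [hu', map_sub, ← d_resCochain, resCochain_extendZero, he, ← h1, sub_sub_cancel]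
  have hdu' : d ρ A _ u' = d ρ A _ u := by rw [hu', map_sub, d_d, sub_zero]
  -- Inclusion–exclusion glues `u'` and `v`: a simplex that lies in both `A` and `B` lies in `C` and
  -- is counted once. Simplices that lie in neither get the value zero, so `z - d w` vanishes on `A`
  -- and on `B` only, and excision has to deal with the rest.
  set w : Cochain ρ Set.univ (n + 1) := extendZero _ u' + extendZero _ v -
    extendZero _ (resCochain ρ hB _ v) with hw
  have hwA : ∀ s : LiftedSimplex x₀ Set.univ (n + 1), (∀ t, s.map t ∈ A) →
      w.1 s = (extendZero Set.univ u').1 s := by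
    intro s hs
    change (extendZero Set.univ u').1 s + (extendZero Set.univ v).1 s -
      (extendZero Set.univ (resCochain ρ hB _ v)).1 s = _
    rw [extendZero_resCochain_apply hB hAB v s hs, add_sub_cancel_right]
  have hwB : ∀ s : LiftedSimplex x₀ Set.univ (n + 1), (∀ t, s.map t ∈ B) →
      w.1 s = (extendZero Set.univ v).1 s := by
    intro s hs
    change (extendZero Set.univ u').1 s + (extendZero Set.univ v).1 s -
      (extendZero Set.univ (resCochain ρ hB _ v)).1 s = _
    rw [← hu'C, extendZero_resCochain_apply hA (fun x hx => hAB hx.symm) u' s hs,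
      add_sub_cancel_left]
  obtain ⟨w', hw'⟩ := hexc (z.1 - d ρ _ _ w) (by rw [map_sub, d_coe_cocycle, d_d, sub_zero])
    (by
      rw [map_sub, h2, ← hdu', sub_eq_zero]
      refine Subtype.ext (funext fun s => ?_)
      refine Eq.symm ((d_apply_congr hwA (s.incl (Set.subset_univ A)) s.mem).trans ?_)
      exact d_extendZero_apply u' (s.incl (Set.subset_univ A)) s.mem)
    (by
      rw [map_sub, h3, sub_eq_zero]
      refine Subtype.ext (funext fun s => ?_)
      refine Eq.symm ((d_apply_congr hwB (s.incl (Set.subset_univ B)) s.mem).trans ?_)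
      exact d_extendZero_apply v (s.incl (Set.subset_univ B)) s.mem)
  exact cls_eq_zero_iff.2 ⟨w' + w, by rw [map_add, hw', sub_add_cancel]⟩

/-- The inverse of the connecting homomorphism, on classes that vanish on `A` and `B`. -/
theorem exists_connecting_inverse {M : Set X} (hCM : C ⊆ M) (hMA : M ⊆ A) (hAB : A ∩ B ⊆ C)
    (hext : ∀ y : cocycles ρ M (n + 1), ∃ y' : cocycles ρ A (n + 1),
      resCochain ρ hMA _ y'.1 = y.1)
    (hexc : ∀ z : Cochain ρ Set.univ (n + 2), d ρ _ _ z = 0 →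
      resCochain ρ (Set.subset_univ A) _ z = 0 → resCochain ρ (Set.subset_univ B) _ z = 0 →
      ∃ w, d ρ _ _ w = z)
    (L : Submodule k (H ρ Set.univ (n + 2)))
    (hLA : ∀ c ∈ L, res ρ (Set.subset_univ A) (n + 2) c = 0)
    (hLB : ∀ c ∈ L, res ρ (Set.subset_univ B) (n + 2) c = 0) :
    ∃ ι : L →ₗ[k] H ρ C (n + 1) ⧸
        LinearMap.range ((res ρ hCM (n + 1)).coprod (-res ρ hB (n + 1))),
      Function.Injective ι ∧ ∀ (c : L) (b : H ρ C (n + 1)),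
        ι c = Submodule.Quotient.mk b ↔ IsConnecting ρ hA hB b c.1 := by
  have hex : ∀ c : L, ∃ b, IsConnecting ρ hA hB b c.1 := fun c =>
    exists_isConnecting c.1 (hLA _ c.2) (hLB _ c.2)
  choose f hf using hex
  -- The elements `b` related to a given class form exactly one coset of the range. The choice of `f
  -- c` is thus irrelevant, which yields linearity and the characterisation of `ι` together.
  have key : ∀ (c : L) (b b' : H ρ C (n + 1)), IsConnecting ρ hA hB b' c.1 →
      ((Submodule.Quotient.mk b' : H ρ C (n + 1) ⧸
        LinearMap.range ((res ρ hCM (n + 1)).coprod (-res ρ hB (n + 1)))) =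
          Submodule.Quotient.mk b ↔ IsConnecting ρ hA hB b c.1) := by
    intro c b b' hb'
    rw [Submodule.Quotient.eq]
    constructor
    · intro h
      have := hb'.sub (isConnecting_zero_of_mem_range (hA := hA) hCM hMA hext h)
      rwa [sub_sub_cancel, sub_zero] at this
    · intro h
      have := hb'.sub h
      rw [sub_self] at this
      exact this.mem_range hCM hMA
  let ι : L →ₗ[k] H ρ C (n + 1) ⧸
      LinearMap.range ((res ρ hCM (n + 1)).coprod (-res ρ hB (n + 1))) :=
    { toFun := fun c => Submodule.Quotient.mk (f c)
      map_add' := fun c c' => (key (c + c') _ _ (hf _)).2 ((hf c).add (hf c'))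
      map_smul' := fun r c => (key (r • c) _ _ (hf _)).2 ((hf c).smul r) }
  refine ⟨ι, ?_, fun c b => key c b _ (hf c)⟩
  rw [injective_iff_map_eq_zero]
  intro c hc
  have h0 : IsConnecting ρ hA hB 0 c.1 := (key c 0 _ (hf c)).1 hc
  exact Subtype.ext (h0.eq_zero hAB hexc)

end MayerVietoris

/-! ### Excision and deformations -/

/-- Excision: a cocycle that vanishes on `A` and on `B` is a coboundary if `X` can be deformed such
that in the end `B` lies in `B` and a neighbourhood of the complement of the interior of `B` lies
in `A`. -/
theorem exists_d_eq_of_deformation {A B U U' : Set X} (G : C(X × unitInterval, X))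
    (hG : ∀ x, G (x, 0) = x) (hU : IsOpen U) (hU' : IsOpen U') (hcover : U ∪ U' = Set.univ)
    (hGU : ∀ x ∈ U, G (x, 1) ∈ A) (hGU' : ∀ x ∈ U', G (x, 1) ∈ B)
    {z : Cochain ρ Set.univ 2} (hz : d ρ _ _ z = 0)
    (hzA : resCochain ρ (Set.subset_univ A) _ z = 0)
    (hzB : resCochain ρ (Set.subset_univ B) _ z = 0) : ∃ w, d ρ _ _ w = z := by
  let F : C(↥(Set.univ : Set X) × unitInterval, ↥(Set.univ : Set X)) :=
    ⟨fun x => ⟨G (x.1.1, x.2), trivial⟩, by fun_prop⟩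
  have hF : ∀ x, F (x, 0) = x := fun x => Subtype.ext (hG x.1)
  have hdz' : d ρ _ _ (z - d ρ _ _ (prismOp ρ F hF z)) = 0 := by
    rw [map_sub, hz, d_d, sub_zero]
  -- The corrected cocycle evaluates `z` at the end of the homotopy. Simplices in `U` or in `U'` end
  -- up in `A` or in `B`, where `z` vanishes.
  have hval : ∀ s, (z - d ρ _ _ (prismOp ρ F hF z)).1 s = z.1 (s.homotopyEnd F hF) := by
    intro s
    change z.1 s - (d ρ _ _ (prismOp ρ F hF z)).1 s = _
    rw [d_prismOp ρ F hF hz, sub_sub_cancel]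
  have hvan : ∀ {S : Set X}, resCochain ρ (Set.subset_univ S) _ z = 0 →
      ∀ s : LiftedSimplex x₀ Set.univ 2, (∀ t, s.map t ∈ S) → z.1 s = 0 := fun h s hs =>
    congrArg (fun y : Cochain ρ _ 2 => y.1 (s.codRestrict hs)) h
  obtain ⟨w, hw⟩ := exists_d_eq_of_vanishing (ι := Bool) (U := fun i => cond i U U')
    (by rintro (_ | _) <;> assumption)
    (by rw [← hcover, Set.union_eq_iUnion]) hdz' (by
      rintro (_ | _) s hs
      · rw [hval]
        refine hvan hzB _ fun t => ?_
        rw [LiftedSimplex.homotopyEnd_map]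
        exact hGU' _ (hs t)
      · rw [hval]
        refine hvan hzA _ fun t => ?_
        rw [LiftedSimplex.homotopyEnd_map]
        exact hGU _ (hs t))
  exact ⟨w + prismOp ρ F hF z, by rw [map_add, hw, sub_add_cancel]⟩

/-- If `T` can be deformed in itself into `S`, a class in degree `2` that vanishes on `S` vanishes
on `T`. -/
theorem res_eq_zero_of_homotopy (F : C(T × unitInterval, T)) (hF : ∀ x, F (x, 0) = x)
    (hFS : ∀ x, (F (x, 1) : X) ∈ S) (c : H ρ Set.univ 2)
    (hc : res ρ (Set.subset_univ S) 2 c = 0) : res ρ (Set.subset_univ T) 2 c = 0 := by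
  obtain ⟨z, rfl⟩ := cls_surjective c
  rw [res_cls, cls_eq_zero_iff] at hc ⊢
  obtain ⟨y, hy⟩ := hc
  refine exists_d_eq_of_homotopy F hF hFS (d_coe_cocycle _) y fun s h => ?_
  rw [hy]
  rfl

/-- If `T` can be deformed in itself into `S` such that the points of `S` do not move, the cocycles
on `S` extend to `T`. -/
theorem exists_cocycle_extension (hST : S ⊆ T) (F : C(T × unitInterval, T))
    (hF : ∀ x, F (x, 0) = x) (hFS : ∀ x, (F (x, 1) : X) ∈ S)
    (hfix : ∀ x : T, x.1 ∈ S → ∀ u, F (x, u) = x) (y : cocycles ρ S n) :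
    ∃ y' : cocycles ρ T n, resCochain ρ hST n y'.1 = y.1 := by
  have hmem : ∀ {m : ℕ} (s : LiftedSimplex x₀ T m) t, (s.homotopyEnd F hF).map t ∈ S :=
    fun s t => by
      rw [LiftedSimplex.homotopyEnd_map]
      exact hFS _
  -- This composes a simplex with the retraction and transports its lift along the homotopy. The
  -- extension of `y` is its pullback by `e`.
  let e {m : ℕ} (s : LiftedSimplex x₀ T m) : LiftedSimplex x₀ S m :=
    (s.homotopyEnd F hF).codRestrict (hmem s)
  have hface : ∀ {m : ℕ} (s : LiftedSimplex x₀ T (m + 1)) i, e (s.face i) = (e s).face i := by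
    intro m s i
    have h : ∀ (a b : LiftedSimplex x₀ T m) (ha : ∀ t, a.map t ∈ S) (hb : ∀ t, b.map t ∈ S),
        a = b → a.codRestrict ha = b.codRestrict hb := by rintro a _ _ _ rfl; rfl
    exact h _ _ _ _ (s.homotopyEnd_face F hF i)
  have hdeck : ∀ {m : ℕ} (s : LiftedSimplex x₀ T m) g, e (s.deck g) = (e s).deck g := by
    intro m s g
    have h : ∀ (a b : LiftedSimplex x₀ T m) (ha : ∀ t, a.map t ∈ S) (hb : ∀ t, b.map t ∈ S),
        a = b → a.codRestrict ha = b.codRestrict hb := by rintro a _ _ _ rfl; rfl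
    exact h _ _ _ _ (s.homotopyEnd_deck F hF g)
  refine ⟨⟨⟨fun s => y.1.1 (e s), fun g s => ?_⟩, ?_⟩, ?_⟩
  · dsimp only
    rw [hdeck]
    exact y.1.2 g _
  · refine Subtype.ext (funext fun s => ?_)
    change ∑ i : Fin (n + 2), (-1 : k) ^ (i : ℕ) • y.1.1 (e (s.face i)) = 0
    simp only [hface]
    exact congrArg (fun c : Cochain ρ S (n + 1) => c.1 (e s)) (d_coe_cocycle y)
  · refine Subtype.ext (funext fun s => ?_)
    change y.1.1 (e (s.incl hST)) = y.1.1 s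
    refine congrArg y.1.1 ?_
    have h := (s.incl hST).homotopyEnd_eq_self F hF fun t u => hfix _ (s.mem t) u
    have h' : ∀ (a : LiftedSimplex x₀ T n) (ha : ∀ t, a.map t ∈ S),
        a = s.incl hST → a.codRestrict ha = s := by rintro _ _ rfl; rfl
    exact h' _ _ h

end Twisted

/-! ### Homotopies on quotient spaces -/

namespace StdCobordism

open Twisted (linePt linePt_zero linePt_one)

lemma continuous_linePt {V : Type*} [NormedAddCommGroup V] [NormedSpace ℝ V] {C : Set V}
    (hC : Convex ℝ C) {Y : Type*} [TopologicalSpace Y] {a b : Y → C} {t : Y → unitInterval}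
    (ha : Continuous a) (hb : Continuous b) (ht : Continuous t) :
    Continuous fun y => linePt hC (a y) (b y) (t y) := by
  unfold linePt
  fun_prop

lemma linePt_self {V : Type*} [NormedAddCommGroup V] [NormedSpace ℝ V] {C : Set V}
    (hC : Convex ℝ C) (a : C) (t : unitInterval) : linePt hC a a t = a := by
  apply Subtype.ext
  change (1 - (t : ℝ)) • (a : V) + (t : ℝ) • (a : V) = a
  module

/-- A family of continuous maps on the source of a quotient map that is compatible with the
identifications gives a continuous map on the product of the quotient with the parameter space. -/
def quotHomotopy {α J Y : Type*} [TopologicalSpace α] [TopologicalSpace J] [LocallyCompactSpace J]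
    [TopologicalSpace Y] {r : α → α → Prop} (g : C(α, C(J, Y))) (hg : ∀ a b, r a b → g a = g b) :
    C(Quot r × J, Y) :=
  -- Continuity is checked for the adjoint map from the quotient to `C(J, Y)`; local compactness of
  -- `J` makes the uncurried map continuous.
  ContinuousMap.uncurry ⟨Quot.lift g hg, continuous_quot_lift hg g.continuous⟩

/-! ### The disc and its retraction to an arc -/

section Disc

lemma convex_disc : Convex ℝ (Metric.closedBall (0 : ℂ) 1) := convex_closedBall 0 1

instance : CompactSpace Disc := isCompact_iff_compactSpace.1 (isCompact_closedBall (0 : ℂ) 1)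

lemma conjDisc_linePt (z w : Disc) (u : unitInterval) :
    conjDisc (linePt convex_disc z w u) = linePt convex_disc (conjDisc z) (conjDisc w) u := by
  apply Subtype.ext
  simp [conjDisc, linePt]

/-- The point `1` of the disc. -/
noncomputable def oneDisc : Disc := circleToDisc 1

lemma conjDisc_oneDisc : conjDisc oneDisc = oneDisc := by
  apply Subtype.ext
  simp [conjDisc, oneDisc, circleToDisc]

/-- The imaginary part of a point of the disc, cut off at the imaginary parts of the end points of
the arc `exp (2 π i t)`, `1 / 3 ≤ t ≤ 2 / 3`. -/
noncomputable def cutIm (z : Disc) : ℝ := max (-(√3 / 2)) (min (√3 / 2) z.1.im)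

lemma cutIm_mem (z : Disc) : -(√3 / 2) ≤ cutIm z ∧ cutIm z ≤ √3 / 2 :=
  ⟨le_max_left _ _, max_le (by linarith [Real.sqrt_nonneg 3]) (min_le_left _ _)⟩

lemma cutIm_sq_le (z : Disc) : cutIm z ^ 2 ≤ 3 / 4 := by
  have h := cutIm_mem z
  have h3 : √3 ^ 2 = 3 := Real.sq_sqrt (by norm_num)
  have := sq_le_sq' h.1 h.2
  rw [div_pow, h3] at this
  linarith

/-- The cut-off interval is symmetric about zero. Through this the retraction commutes with
conjugation, as the gluing of the ends of `V` requires. -/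
lemma cutIm_conjDisc (z : Disc) : cutIm (conjDisc z) = -cutIm z := by
  simp only [cutIm, conjDisc, Complex.conj_im]
  rw [← min_neg_neg, ← max_neg_neg, neg_neg, max_min_distrib_left, max_eq_right]
  linarith [Real.sqrt_nonneg 3]

/-- The retraction of the disc to the arc `exp (2 π i t)`, `1 / 3 ≤ t ≤ 2 / 3`. -/
noncomputable def arcRetract (z : Disc) : Disc :=
  ⟨⟨-√(1 - cutIm z ^ 2), cutIm z⟩, by
    rw [mem_closedBall_zero_iff, ← sq_le_one_iff₀ (norm_nonneg _), ← Complex.normSq_eq_norm_sq,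
      Complex.normSq_mk]
    have := Real.mul_self_sqrt (show 0 ≤ 1 - cutIm z ^ 2 by linarith [cutIm_sq_le z])
    nlinarith⟩

lemma continuous_arcRetract : Continuous arcRetract := by
  refine Continuous.subtype_mk ?_ _
  have h : Continuous cutIm := by
    unfold cutIm
    fun_prop
  exact Complex.equivRealProdCLM.symm.continuous.comp
    (((continuous_const.sub (h.pow 2)).sqrt.neg).prodMk h)

lemma conjDisc_arcRetract (z : Disc) : conjDisc (arcRetract z) = arcRetract (conjDisc z) := by
  apply Subtype.ext
  apply Complex.ext
  · change -√(1 - cutIm z ^ 2) = -√(1 - cutIm (conjDisc z) ^ 2)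
    rw [cutIm_conjDisc, neg_sq]
  · exact (cutIm_conjDisc z).symm

/-- The point `exp (2 π i t)` of the disc. -/
noncomputable def arcPt (t : ℝ) : Disc := circleToDisc (Circle.exp (2 * Real.pi * t))

lemma arcPt_re (t : ℝ) : (arcPt t).1.re = Real.cos (2 * Real.pi * t) := by
  simp only [arcPt, circleToDisc, Circle.coe_exp, Complex.exp_ofReal_mul_I_re]

lemma arcPt_im (t : ℝ) : (arcPt t).1.im = Real.sin (2 * Real.pi * t) := by
  simp only [arcPt, circleToDisc, Circle.coe_exp, Complex.exp_ofReal_mul_I_im]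

lemma arcPt_re_le {t : ℝ} (ht : t ∈ Set.Icc (1 / 3 : ℝ) (2 / 3)) : (arcPt t).1.re ≤ -(1 / 2) := by
  rw [arcPt_re, ← neg_neg (Real.cos _), ← Real.cos_sub_pi, neg_le_neg_iff, ← Real.cos_abs,
    ← Real.cos_pi_div_three]
  have hπ := Real.pi_pos
  apply Real.cos_le_cos_of_nonneg_of_le_pi (abs_nonneg _) (by linarith)
  rw [abs_le]
  constructor <;> nlinarith [ht.1, ht.2]

lemma arcRetract_arcPt {t : ℝ} (ht : t ∈ Set.Icc (1 / 3 : ℝ) (2 / 3)) :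
    arcRetract (arcPt t) = arcPt t := by
  have h1 := arcPt_re_le ht
  have h2 : (arcPt t).1.re ^ 2 + (arcPt t).1.im ^ 2 = 1 := by
    rw [arcPt_re, arcPt_im, Real.cos_sq_add_sin_sq]
  have h3 : (arcPt t).1.im ^ 2 ≤ (√3 / 2) ^ 2 := by
    rw [div_pow, Real.sq_sqrt (by norm_num)]
    nlinarith
  have h4 := abs_le_of_sq_le_sq' h3 (by positivity)
  have hcut : cutIm (arcPt t) = (arcPt t).1.im := by
    rw [cutIm, min_eq_right h4.2, max_eq_right h4.1]
  apply Subtype.ext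
  apply Complex.ext
  · change -√(1 - cutIm (arcPt t) ^ 2) = _
    rw [hcut, show 1 - (arcPt t).1.im ^ 2 = (-(arcPt t).1.re) ^ 2 by linarith,
      Real.sqrt_sq (by linarith), neg_neg]
  · exact hcut

/-- The retracted point has imaginary part `cutIm z` and negative real part, so its angle is `π -
arcsin (cutIm z)`. The bound `√3 / 2` on the imaginary part keeps this angle within `π / 3` of `π`.
-/
lemma exists_arcRetract_eq (z : Disc) :
    ∃ t ∈ Set.Icc (1 / 3 : ℝ) (2 / 3), arcRetract z = arcPt t := by
  have hz := cutIm_mem z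
  have hπ := Real.pi_pos
  have h1 : Real.arcsin (cutIm z) ≤ Real.pi / 3 := by
    rw [Real.arcsin_le_iff_le_sin' ⟨by linarith, by linarith⟩, Real.sin_pi_div_three]
    exact hz.2
  have h2 : -(Real.pi / 3) ≤ Real.arcsin (cutIm z) := by
    rw [Real.le_arcsin_iff_sin_le' ⟨by linarith, by linarith⟩, Real.sin_neg,
      Real.sin_pi_div_three]
    exact hz.1
  have hsq := cutIm_sq_le z
  have habs := abs_le_of_sq_le_sq' (show cutIm z ^ 2 ≤ 1 ^ 2 by linarith) zero_le_one
  have hmul : 2 * Real.pi * (1 / 2 - Real.arcsin (cutIm z) / (2 * Real.pi)) =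
      Real.pi - Real.arcsin (cutIm z) := by
    field_simp
  refine ⟨1 / 2 - Real.arcsin (cutIm z) / (2 * Real.pi), ⟨?_, ?_⟩, ?_⟩
  · have : Real.arcsin (cutIm z) / (2 * Real.pi) ≤ 1 / 6 := by
      rw [div_le_iff₀ (by positivity)]; linarith
    linarith
  · have : -(1 / 6) ≤ Real.arcsin (cutIm z) / (2 * Real.pi) := by
      rw [le_div_iff₀ (by positivity)]; linarith
    linarith
  · apply Subtype.ext
    apply Complex.ext
    · rw [arcPt_re, hmul, Real.cos_pi_sub, Real.cos_arcsin]
      rfl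
    · rw [arcPt_im, hmul, Real.sin_pi_sub, Real.sin_arcsin habs.1 habs.2]
      rfl

lemma arcPt_injOn : Set.InjOn arcPt (Set.Icc (1 / 3 : ℝ) (2 / 3)) := by
  intro a ha b hb hab
  have hcirc : Circle.exp (2 * Real.pi * a) = Circle.exp (2 * Real.pi * b) :=
    Circle.ext (show (arcPt a).1 = (arcPt b).1 by rw [hab])
  obtain ⟨m, hm⟩ := Circle.exp_eq_exp.1 hcirc
  have hπ := Real.pi_pos
  have hm' : a = b + m := by
    have : 2 * Real.pi * a = 2 * Real.pi * (b + m) := by rw [hm]; ring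
    exact mul_left_cancel₀ (by positivity) this
  have h1 : (m : ℝ) < 1 := by linarith [ha.2, hb.1]
  have h2 : (-1 : ℝ) < m := by linarith [ha.1, hb.2]
  have h3 : m = 0 := by
    have h1' : m < 1 := by exact_mod_cast h1
    have h2' : -1 < m := by exact_mod_cast h2
    omega
  rw [hm', h3, Int.cast_zero, add_zero]

end Disc

/-! ### Stretching the interval coordinate -/

section Interval

/-- A map of the unit interval that fixes the end points and the points of `[1 / 3, 2 / 3]` and maps
`[1 / 6, 5 / 6]` to `[1 / 3, 2 / 3]`. -/
noncomputable def stretch (s : unitInterval) : unitInterval :=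
  ⟨max (max (min (2 * s) (1 / 3)) (min s (2 / 3))) (2 * s - 1), by
    obtain ⟨s, h0, h1⟩ := s
    refine ⟨le_max_of_le_left (le_max_of_le_right (le_min h0 (by norm_num))), ?_⟩
    refine max_le (max_le (min_le_of_right_le (by norm_num)) (min_le_of_left_le h1)) ?_
    dsimp only
    linarith⟩

lemma continuous_stretch : Continuous stretch := by
  unfold stretch
  fun_prop

lemma stretch_zero : stretch 0 = 0 := by
  apply Subtype.ext
  norm_num [stretch]

lemma stretch_one : stretch 1 = 1 := by
  apply Subtype.ext
  norm_num [stretch]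

lemma stretch_eq_self {s : unitInterval} (h1 : 1 / 3 ≤ (s : ℝ)) (h2 : (s : ℝ) ≤ 2 / 3) :
    stretch s = s := by
  apply Subtype.ext
  simp only [stretch]
  rw [min_eq_right (by linarith), min_eq_left h2, max_eq_right h1, max_eq_left (by linarith)]

lemma stretch_mem {s : unitInterval} (h1 : 1 / 6 ≤ (s : ℝ)) (h2 : (s : ℝ) ≤ 5 / 6) :
    (stretch s : ℝ) ∈ Set.Icc (1 / 3 : ℝ) (2 / 3) := by
  refine ⟨le_max_of_le_left (le_max_of_le_left (le_min (by linarith) le_rfl)), ?_⟩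
  exact max_le (max_le (min_le_of_right_le (by norm_num)) (min_le_right _ _)) (by linarith)

end Interval

/-! ### Functions and deformations on `V` -/

section V

/-- The real part of the disc coordinate of a point of `V`. -/
noncomputable def reV : V → ℝ :=
  Quot.lift (fun p => p.2.2.1.re) (by rintro _ _ ⟨l, z⟩; simp [conjDisc])

/-- The distance of the interval coordinate of a point of `V` from the end points, cut off at
`1 / 3`. -/
noncomputable def capV : V → ℝ :=
  Quot.lift (fun p => min (min (p.1 : ℝ) (1 - p.1)) (1 / 3)) (by rintro _ _ ⟨l, z⟩; simp)

lemma continuous_capV : Continuous capV :=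
  continuous_quot_lift _ (by fun_prop)

lemma continuous_vMk : Continuous fun p : unitInterval × Circle × Disc => V.mk p.1 p.2.1 p.2.2 :=
  continuous_quot_mk

/-- Identifications occur only at the ends of the interval, so equality with an interior point `p`
is a predicate that descends to the quotient. -/
lemma vMk_inj {p q : unitInterval × Circle × Disc} (h0 : 0 < p.1) (h1 : p.1 < 1)
    (h : Quot.mk VRel q = Quot.mk VRel p) : q = p := by
  let P : Quot VRel → Prop := Quot.lift (fun x => x = p) (by
    rintro _ _ ⟨l, z⟩
    refine propext ⟨?_, ?_⟩
    · rintro rfl; exact absurd h0 (lt_irrefl _)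
    · rintro rfl; exact absurd h1 (lt_irrefl _))
  have : P (Quot.mk VRel q) := by rw [h]
  exact this

/-- A homotopy of `[0, 1] × S¹ × D²` that acts on the first and the last coordinate and is compatible
with the identifications, as a homotopy of `V`. -/
noncomputable def homotopyV (a : unitInterval → unitInterval) (b : Disc → Disc)
    (ha : Continuous a) (hb : Continuous b) (ha0 : a 0 = 0) (ha1 : a 1 = 1)
    (hconj : ∀ z, conjDisc (b z) = b (conjDisc z)) : C(V × unitInterval, V) :=
  quotHomotopy (r := VRel) (ContinuousMap.curry
    ⟨fun x : (unitInterval × Circle × Disc) × unitInterval =>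
      V.mk (linePt (convex_Icc 0 1) x.1.1 (a x.1.1) x.2) x.1.2.1
        (linePt convex_disc x.1.2.2 (b x.1.2.2) x.2),
      continuous_vMk.comp <| (continuous_linePt (convex_Icc 0 1)
        (by fun_prop) (by fun_prop) (by fun_prop)).prodMk
        ((by fun_prop : Continuous fun x : (unitInterval × Circle × Disc) × unitInterval =>
          x.1.2.1).prodMk
          (continuous_linePt convex_disc (by fun_prop) (by fun_prop) (by fun_prop)))⟩) (by
    rintro _ _ ⟨l, z⟩
    ext1 u
    change V.mk (linePt _ 0 (a 0) u) l (linePt _ z (b z) u) =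
      V.mk (linePt _ 1 (a 1) u) l⁻¹ (linePt _ (conjDisc z) (b (conjDisc z)) u)
    rw [ha0, ha1, linePt_self, linePt_self, ← hconj, ← conjDisc_linePt]
    exact Quot.sound (VRel.glue _ _))

lemma homotopyV_mk {a : unitInterval → unitInterval} {b : Disc → Disc} (ha : Continuous a)
    (hb : Continuous b) (ha0 : a 0 = 0) (ha1 : a 1 = 1)
    (hconj : ∀ z, conjDisc (b z) = b (conjDisc z)) (s : unitInterval) (l : Circle) (z : Disc)
    (u : unitInterval) : homotopyV a b ha hb ha0 ha1 hconj (V.mk s l z, u) =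
      V.mk (linePt (convex_Icc 0 1) s (a s) u) l (linePt convex_disc z (b z) u) :=
  rfl

lemma homotopyV_zero {a : unitInterval → unitInterval} {b : Disc → Disc} (ha : Continuous a)
    (hb : Continuous b) (ha0 : a 0 = 0) (ha1 : a 1 = 1)
    (hconj : ∀ z, conjDisc (b z) = b (conjDisc z)) (v : V) :
    homotopyV a b ha hb ha0 ha1 hconj (v, 0) = v := by
  obtain ⟨⟨s, l, z⟩, rfl⟩ := Quot.exists_rep v
  refine (homotopyV_mk ha hb ha0 ha1 hconj s l z 0).trans ?_
  rw [linePt_zero, linePt_zero]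
  rfl

variable (h : Disc ≃ₜ Square)

/-- The point of `[0, 1] × S¹ × D²` that represents the image in `V` of a point of `S¹ × D²`. -/
noncomputable def tubeRep (p : Circle × Disc) : unitInterval × Circle × Disc :=
  (⟨(h p.2).1.1, by constructor <;> linarith [(h p.2).1.2.1, (h p.2).1.2.2]⟩, p.1,
    arcPt (h p.2).2.1)

/-- The gluing map from `S¹ × D²` to `V`. -/
noncomputable def tubeMap (p : Circle × Disc) : V := squareToV p.1 (h p.2)

lemma continuous_tubeRep : Continuous (tubeRep h) := by
  have h1 : Continuous arcPt := by
    unfold arcPt circleToDisc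
    fun_prop
  unfold tubeRep
  fun_prop

lemma tubeRep_injective : Function.Injective (tubeRep h) := by
  intro p q hpq
  have h1 : ((h p.2).1 : ℝ) = (h q.2).1 := congrArg (fun x => (x.1 : ℝ)) hpq
  have h2 : ((h p.2).2 : ℝ) = (h q.2).2 := arcPt_injOn (h p.2).2.2 (h q.2).2.2
    (congrArg (fun x => x.2.2) hpq)
  exact Prod.ext (congrArg (fun x => x.2.1) hpq)
    (h.injective (Prod.ext (Subtype.ext h1) (Subtype.ext h2)))

lemma tubeRep_pos (p : Circle × Disc) : 0 < (tubeRep h p).1 := by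
  have := (h p.2).1.2.1
  exact Subtype.coe_lt_coe.1 (lt_of_lt_of_le (by norm_num) this)

lemma tubeRep_lt (p : Circle × Disc) : (tubeRep h p).1 < 1 := by
  have := (h p.2).1.2.2
  exact Subtype.coe_lt_coe.1 (lt_of_le_of_lt this (by norm_num))

lemma tubeMap_injective : Function.Injective (tubeMap h) := fun _ q hpq =>
  tubeRep_injective h (vMk_inj (tubeRep_pos h q) (tubeRep_lt h q) hpq)

/-- The glued solid torus stays away from the ends of the interval. The preimage of the image of `D`
is therefore just `tubeRep h '' D`, which is compact. -/
lemma isClosedMap_tubeMap : IsClosedMap (tubeMap h) := by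
  intro D hD
  refine isQuotientMap_quot_mk.isClosed_preimage.1 ?_
  change IsClosed (Quot.mk VRel ⁻¹' (tubeMap h '' D))
  have : Quot.mk VRel ⁻¹' (tubeMap h '' D) = tubeRep h '' D := by
    ext x
    constructor
    · rintro ⟨p, hp, hpx⟩
      exact ⟨p, hp, (vMk_inj (tubeRep_pos h p) (tubeRep_lt h p) hpx.symm).symm⟩
    · rintro ⟨p, hp, rfl⟩
      exact ⟨p, hp, rfl⟩
  rw [this]
  exact (hD.isCompact.image (continuous_tubeRep h)).isClosed

/-- This constancy is what allows `capV` to be extended to the cylinder by `1 / 3`. -/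
lemma capV_tubeMap (p : Circle × Disc) : capV (tubeMap h p) = 1 / 3 := by
  have h1 := (h p.2).1.2
  change min (min ((h p.2).1 : ℝ) (1 - (h p.2).1)) (1 / 3) = 1 / 3
  exact min_eq_right (le_min h1.1 (by linarith [h1.2]))

/-- This separates the solid torus from the points with `z = 1`, to which `V` is deformed. -/
lemma reV_tubeMap_neg (p : Circle × Disc) : reV (tubeMap h p) < 0 := by
  have := arcPt_re_le (h p.2).2.2
  change (arcPt (h p.2).2).1.re < 0
  linarith

/-- The deformation of `V` that moves a neighbourhood of the glued solid torus into it. -/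
noncomputable def tubeHomotopy : C(V × unitInterval, V) :=
  homotopyV stretch arcRetract continuous_stretch continuous_arcRetract stretch_zero stretch_one
    conjDisc_arcRetract

lemma tubeHomotopy_tubeMap (p : Circle × Disc) (u : unitInterval) :
    tubeHomotopy (tubeMap h p, u) = tubeMap h p := by
  refine (homotopyV_mk _ _ _ _ _ (tubeRep h p).1 p.1 (arcPt (h p.2).2) u).trans ?_
  rw [arcRetract_arcPt (h p.2).2.2, stretch_eq_self (h p.2).1.2.1 (h p.2).1.2.2, linePt_self,
    linePt_self]
  rfl

/-- The assumption puts the interval coordinate strictly between `1 / 6` and `5 / 6`, so `stretch`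
takes it to `[1 / 3, 2 / 3]`. The disc coordinate is retracted to the arc wherever it was. -/
lemma tubeHomotopy_one_mem {v : V} (hv : 1 / 6 < capV v) :
    tubeHomotopy (v, 1) ∈ Set.range (tubeMap h) := by
  obtain ⟨⟨s, l, z⟩, rfl⟩ := Quot.exists_rep v
  have hs : 1 / 6 < min (min (s : ℝ) (1 - s)) (1 / 3) := hv
  rw [lt_min_iff, lt_min_iff] at hs
  obtain ⟨t, ht, hzt⟩ := exists_arcRetract_eq z
  have hs' := stretch_mem (s := s) (by linarith [hs.1.1]) (by linarith [hs.1.2])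
  refine ⟨(l, h.symm (⟨_, hs'⟩, ⟨t, ht⟩)), ?_⟩
  refine Eq.trans ?_ (homotopyV_mk _ _ _ _ _ s l z 1).symm
  rw [linePt_one, linePt_one, hzt, tubeMap, h.apply_symm_apply]
  rfl

/-- The deformation of `V` to the points with last coordinate `1`. -/
noncomputable def sectionHomotopy : C(V × unitInterval, V) :=
  homotopyV id (fun _ => oneDisc) continuous_id continuous_const rfl rfl
    fun _ => conjDisc_oneDisc

lemma sectionHomotopy_one_mem (v : V) : sectionHomotopy (v, 1) ∈ boundaryV \ openTubeV h := by
  obtain ⟨⟨s, l, z⟩, rfl⟩ := Quot.exists_rep v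
  have : sectionHomotopy (V.mk s l z, 1) = V.mk s l oneDisc := by
    refine (homotopyV_mk _ _ _ _ _ s l z 1).trans ?_
    rw [linePt_one, linePt_one]
    rfl
  change sectionHomotopy (V.mk s l z, 1) ∈ _
  rw [this]
  refine ⟨⟨s, l, 1, rfl⟩, ?_⟩
  rintro ⟨l', x, -, hx⟩
  have h1 := reV_tubeMap_neg h (l', x)
  rw [tubeMap, hx] at h1
  have h2 : reV (V.mk s l oneDisc) = 1 := rfl
  linarith

end V

/-! ### The two pieces of `W` as embedded subspaces -/

section W

variable {M : Type*} {φ : Circle × Disc → M} {h : Disc ≃ₜ Square}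

variable (φ h) in
lemma ofCyl_eq_ofV (p : Circle × Disc) : ofCyl φ h (1, φ p) = ofV φ h (tubeMap h p) :=
  Quot.sound (WRel.glue p.1 p.2)

variable (h) in
/-- A set of points of the cylinder and the points of `V` that are identified with them. -/
def saturateCyl (φ : Circle × Disc → M) (C : Set (unitInterval × M)) :
    Set ((unitInterval × M) ⊕ V) :=
  {x | Sum.elim (· ∈ C) (· ∈ tubeMap h '' ((fun p' => (1, φ p')) ⁻¹' C)) x}

variable (h) in
/-- A set of points of `V` and the points of the cylinder that are identified with them. -/
def saturateV (φ : Circle × Disc → M) (C : Set V) : Set ((unitInterval × M) ⊕ V) :=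
  {x | Sum.elim (· ∈ (fun p => ((1 : unitInterval), φ p)) '' (tubeMap h ⁻¹' C)) (· ∈ C) x}

/-- Membership in the saturation respects the gluing since `tubeMap` is injective, so it descends to
`W`. The description gives the injectivity and closedness of `ofCyl`, and also the intersection of
the two pieces. -/
lemma mk_preimage_ofCyl_image (C : Set (unitInterval × M)) :
    Quot.mk (WRel φ h) ⁻¹' (ofCyl φ h '' C) = saturateCyl h φ C := by
  ext x
  constructor
  · rintro ⟨q, hq, hqx⟩
    let P : Quot (WRel φ h) → Prop := Quot.lift (· ∈ saturateCyl h φ C) (by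
      rintro _ _ ⟨l, y⟩
      refine propext ⟨fun hy => ⟨(l, y), hy, rfl⟩, ?_⟩
      rintro ⟨p, hp, hpy⟩
      rw [show p = (l, y) from tubeMap_injective h hpy] at hp
      exact hp)
    have : P (Quot.mk (WRel φ h) x) := by
      rw [← hqx]
      exact hq
    exact this
  · rcases x with q | v
    · intro hq
      exact ⟨q, hq, rfl⟩
    · rintro ⟨p, hp, rfl⟩
      exact ⟨_, hp, ofCyl_eq_ofV φ h p⟩

lemma mk_preimage_ofV_image (hφ : Function.Injective φ) (C : Set V) :
    Quot.mk (WRel φ h) ⁻¹' (ofV φ h '' C) = saturateV h φ C := by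
  ext x
  constructor
  · rintro ⟨q, hq, hqx⟩
    let P : Quot (WRel φ h) → Prop := Quot.lift (· ∈ saturateV h φ C) (by
      rintro _ _ ⟨l, y⟩
      refine propext ⟨?_, fun hy => ⟨(l, y), hy, rfl⟩⟩
      rintro ⟨p, hp, hpy⟩
      rw [show p = (l, y) from hφ (congrArg Prod.snd hpy)] at hp
      exact hp)
    have : P (Quot.mk (WRel φ h) x) := by
      rw [← hqx]
      exact hq
    exact this
  · rcases x with q | v
    · rintro ⟨p, hp, rfl⟩
      exact ⟨_, hp, (ofCyl_eq_ofV φ h p).symm⟩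
    · intro hq
      exact ⟨v, hq, rfl⟩

lemma ofCyl_injective : Function.Injective (ofCyl φ h) := by
  intro q q' hqq
  have : Sum.inl q ∈ Quot.mk (WRel φ h) ⁻¹' (ofCyl φ h '' {q'}) := ⟨q', rfl, hqq.symm⟩
  rw [mk_preimage_ofCyl_image] at this
  exact this

lemma ofV_injective (hφ : Function.Injective φ) : Function.Injective (ofV φ h) := by
  intro v v' hvv
  have : Sum.inr v ∈ Quot.mk (WRel φ h) ⁻¹' (ofV φ h '' {v'}) := ⟨v', rfl, hvv.symm⟩
  rw [mk_preimage_ofV_image hφ] at this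
  exact this

lemma cylPart_inter_VPart : cylPart φ h ∩ VPart φ h ⊆ tube φ h := by
  rintro _ ⟨⟨q, rfl⟩, ⟨v, hv⟩⟩
  have : Sum.inr v ∈ Quot.mk (WRel φ h) ⁻¹' (ofCyl φ h '' {q}) := ⟨q, rfl, hv.symm⟩
  rw [mk_preimage_ofCyl_image] at this
  obtain ⟨p, -, rfl⟩ := this
  exact ⟨p, hv⟩

variable [TopologicalSpace M]

lemma continuous_ofCyl : Continuous (ofCyl φ h) := continuous_quot_mk.comp continuous_inl

lemma continuous_ofV : Continuous (ofV φ h) := continuous_quot_mk.comp continuous_inr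

lemma isClosedEmbedding_ofCyl (hφ : Continuous φ) : IsClosedEmbedding (ofCyl φ h) := by
  refine .of_continuous_injective_isClosedMap continuous_ofCyl ofCyl_injective fun C hC => ?_
  refine isQuotientMap_quot_mk.isClosed_preimage.1 ?_
  change IsClosed (Quot.mk (WRel φ h) ⁻¹' (ofCyl φ h '' C))
  rw [mk_preimage_ofCyl_image, isClosed_sum_iff]
  exact ⟨hC, isClosedMap_tubeMap h _ (hC.preimage (by fun_prop))⟩

lemma continuous_tubeMap : Continuous (tubeMap h) :=
  continuous_quot_mk.comp (continuous_tubeRep h)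

/-- The part of the saturation in the cylinder is the image of a closed subset of the compact solid
torus, hence compact, and it is closed because `M` is Hausdorff. -/
lemma isClosedEmbedding_ofV [T2Space M] (hφ : IsEmbedding φ) :
    IsClosedEmbedding (ofV φ h) := by
  refine .of_continuous_injective_isClosedMap continuous_ofV (ofV_injective hφ.injective)
    fun C hC => ?_
  refine isQuotientMap_quot_mk.isClosed_preimage.1 ?_
  change IsClosed (Quot.mk (WRel φ h) ⁻¹' (ofV φ h '' C))
  rw [mk_preimage_ofV_image hφ.injective, isClosed_sum_iff]
  have hc : Continuous fun p => ((1 : unitInterval), φ p) :=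
    continuous_const.prodMk hφ.continuous
  exact ⟨((hC.preimage continuous_tubeMap).isCompact.image hc).isClosed, hC⟩

end W

/-! ### Deformations of `W` and of the cylinder -/

section Deformations

open Twisted (linePt linePt_zero linePt_one)
open unitInterval (symm)

variable {M : Type*} [TopologicalSpace M] {φ : Circle × Disc → M} {h : Disc ≃ₜ Square}

/-- The function `capV`, extended by `1 / 3` to the cylinder. -/
noncomputable def capW : W φ h → ℝ :=
  Quot.lift (Sum.elim (fun _ => 1 / 3) capV) (by
    rintro _ _ ⟨l, x⟩
    exact (capV_tubeMap h (l, x)).symm)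

lemma continuous_capW : Continuous (capW (φ := φ) (h := h)) :=
  continuous_quot_lift _ (continuous_const.sumElim continuous_capV)

/-- The deformation of `W` that is constant on the cylinder and is `tubeHomotopy` on `V`. -/
noncomputable def collarHomotopy : C(W φ h × unitInterval, W φ h) :=
  quotHomotopy (r := WRel φ h)
    ⟨Sum.elim
      (ContinuousMap.curry ⟨fun x : (unitInterval × M) × unitInterval => ofCyl φ h x.1,
        continuous_ofCyl.comp continuous_fst⟩)
      (ContinuousMap.curry ⟨fun x : V × unitInterval => ofV φ h (tubeHomotopy x),
        continuous_ofV.comp tubeHomotopy.continuous⟩),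
      (ContinuousMap.continuous _).sumElim (ContinuousMap.continuous _)⟩ (by
    rintro _ _ ⟨l, x⟩
    ext1 u
    change ofCyl φ h (1, φ (l, x)) = ofV φ h (tubeHomotopy (tubeMap h (l, x), u))
    rw [tubeHomotopy_tubeMap, ofCyl_eq_ofV])

lemma collarHomotopy_ofV (v : V) (u : unitInterval) :
    collarHomotopy (ofV φ h v, u) = ofV φ h (tubeHomotopy (v, u)) := rfl

lemma exists_rep_W (w : W φ h) : (∃ q, w = ofCyl φ h q) ∨ ∃ v, w = ofV φ h v := by
  obtain ⟨q | v, rfl⟩ := Quot.exists_rep w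
  · exact .inl ⟨q, rfl⟩
  · exact .inr ⟨v, rfl⟩

lemma collarHomotopy_zero (w : W φ h) : collarHomotopy (w, 0) = w := by
  rcases exists_rep_W w with ⟨q, rfl⟩ | ⟨v, rfl⟩
  · rfl
  · rw [collarHomotopy_ofV, tubeHomotopy, homotopyV_zero]

lemma collarHomotopy_one_mem_cylPart {w : W φ h} (hw : 1 / 6 < capW w) :
    collarHomotopy (w, 1) ∈ cylPart φ h := by
  rcases exists_rep_W w with ⟨q, rfl⟩ | ⟨v, rfl⟩
  · exact ⟨q, rfl⟩
  · obtain ⟨p, hp⟩ := tubeHomotopy_one_mem h (v := v) hw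
    exact ⟨(1, φ p), by rw [ofCyl_eq_ofV, hp]; rfl⟩

lemma collarHomotopy_one_mem_VPart {w : W φ h} (hw : capW w < 1 / 3) :
    collarHomotopy (w, 1) ∈ VPart φ h := by
  rcases exists_rep_W w with ⟨q, rfl⟩ | ⟨v, rfl⟩
  -- On the cylinder `capW` equals `1 / 3`, so no point of it satisfies the strict inequality unless
  -- it is also represented in `V`.
  · exact absurd hw (lt_irrefl _)
  · exact ⟨_, rfl⟩

/-- The homotopy of the image of an embedding given by a homotopy of its source. -/
noncomputable def rangeHomotopy {Y Z : Type*} [TopologicalSpace Y] [TopologicalSpace Z] {f : Y → Z}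
    (hf : IsEmbedding f) (g : C(Y × unitInterval, Y)) :
    C(Set.range f × unitInterval, Set.range f) where
  toFun x := ⟨f (g (hf.toHomeomorph.symm x.1, x.2)), _, rfl⟩
  continuous_toFun := Continuous.subtype_mk (hf.continuous.comp (g.continuous.comp (by fun_prop))) _

lemma rangeHomotopy_apply {Y Z : Type*} [TopologicalSpace Y] [TopologicalSpace Z] {f : Y → Z}
    (hf : IsEmbedding f) (g : C(Y × unitInterval, Y)) (y : Y) (u : unitInterval) :
    rangeHomotopy hf g (⟨f y, y, rfl⟩, u) = ⟨f (g (y, u)), _, rfl⟩ := by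
  have : hf.toHomeomorph.symm ⟨f y, y, rfl⟩ = y := hf.toHomeomorph.symm_apply_apply y
  apply Subtype.ext
  change f (g (hf.toHomeomorph.symm ⟨f y, y, rfl⟩, u)) = f (g (y, u))
  rw [this]

/-- The deformation of the cylinder to its end at `0`. -/
def cylToZero (M : Type*) [TopologicalSpace M] :
    C((unitInterval × M) × unitInterval, unitInterval × M) where
  toFun x := (x.1.1 * symm x.2, x.1.2)
  continuous_toFun := by fun_prop

/-- The deformation of the cylinder to its end at `1`. -/
def cylToOne (M : Type*) [TopologicalSpace M] :
    C((unitInterval × M) × unitInterval, unitInterval × M) where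
  toFun x := (symm (symm x.1.1 * symm x.2), x.1.2)
  continuous_toFun := by fun_prop

end Deformations

end StdCobordism

/-! ### The theorem -/

open StdCobordism

theorem lemma3 {M : Type*} [TopologicalSpace M] [T2Space M] [CompactSpace M] [ConnectedSpace M]
    [ChartedSpace (EuclideanSpace ℝ (Fin 3)) M]
    (φ : Circle × Disc → M) (hφ : IsEmbedding φ) (h : Disc ≃ₜ Square)
    (w₀ : W φ h) (α : FundamentalGroup (W φ h) w₀ →* SU2) :
    ∃ ι : L2H2 α →ₗ[ℂ] CokerH1 α, Function.Injective ι ∧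
      ∀ (c : L2H2 α) (b : Twisted.H (coeff α) (tube φ h) 1),
        ι c = Submodule.Quotient.mk b ↔
          Twisted.IsConnecting (coeff α) (tube_subset_cylPart φ h) (tube_subset_VPart φ h) b c.1 := by
  have hcyl := (isClosedEmbedding_ofCyl (h := h) hφ.continuous).isEmbedding
  have hV := (isClosedEmbedding_ofV (h := h) hφ).isEmbedding
  refine Twisted.exists_connecting_inverse (tube_subset_MPart φ h) (MPart_subset_cylPart φ h)
    cylPart_inter_VPart ?_ ?_ (L2H2 α) ?_ ?_
  -- The cylinder retracts to its end at `1`, whose points stay fixed throughout.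
  · refine Twisted.exists_cocycle_extension _ (rangeHomotopy hcyl (cylToOne M)) ?_ ?_ ?_
    · rintro ⟨_, q, rfl⟩
      refine (rangeHomotopy_apply hcyl _ q 0).trans (Subtype.ext ?_)
      simp [cylToOne]
    · rintro ⟨_, q, rfl⟩
      refine (congrArg (fun x : Set.range (ofCyl φ h) => x.1 ∈ MPart φ h)
        (rangeHomotopy_apply hcyl _ q 1)).mpr ⟨q.2, ?_⟩
      simp [cylToOne]
    · rintro ⟨_, hq⟩ ⟨m, rfl⟩ u
      refine (rangeHomotopy_apply hcyl _ (1, m) u).trans (Subtype.ext ?_)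
      simp [cylToOne]
  · intro z hz hzA hzB
    -- The open sets `1 / 6 < capW` and `capW < 1 / 3` overlap, hence cover `W`. The first contains
    -- the whole cylinder, the second lies in `V`.
    refine Twisted.exists_d_eq_of_deformation collarHomotopy collarHomotopy_zero
      (isOpen_lt continuous_const continuous_capW) (isOpen_lt continuous_capW continuous_const) ?_
      (fun w => collarHomotopy_one_mem_cylPart) (fun w => collarHomotopy_one_mem_VPart) hz hzA hzB
    refine Set.eq_univ_of_forall fun w => ?_
    rcases lt_or_ge (1 / 6) (capW w) with hw | hw
    · exact .inl hw
    · exact .inr (hw.trans_lt (by norm_num))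
  · intro c hc
    -- Here the opposite end is used: `{0} × M` lies entirely in `∂W`, whereas `{1} × M` does so
    -- only outside the open solid torus.
    refine Twisted.res_eq_zero_of_homotopy (rangeHomotopy hcyl (cylToZero M)) ?_ ?_ c hc
    · rintro ⟨_, q, rfl⟩
      refine (rangeHomotopy_apply hcyl _ q 0).trans (Subtype.ext ?_)
      simp [cylToZero]
    · rintro ⟨_, q, rfl⟩
      refine (congrArg (fun x : Set.range (ofCyl φ h) => x.1 ∈ boundaryW φ h)
        (rangeHomotopy_apply hcyl _ q 1)).mpr (.inl (.inl ⟨q.2, ?_⟩))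
      simp [cylToZero]
  · intro c hc
    refine Twisted.res_eq_zero_of_homotopy (rangeHomotopy hV sectionHomotopy) ?_ ?_ c hc
    · rintro ⟨_, v, rfl⟩
      refine (rangeHomotopy_apply hV _ v 0).trans (Subtype.ext ?_)
      simp [sectionHomotopy, homotopyV_zero]
    · rintro ⟨_, v, rfl⟩
      exact (congrArg (fun x : Set.range (ofV φ h) => x.1 ∈ boundaryW φ h)
        (rangeHomotopy_apply hV _ v 1)).mpr (.inr ⟨_, sectionHomotopy_one_mem h v, rfl⟩)
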